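/- For $a,b,c\in\mathbb{C}$ with $c\notin\{0,-1,-2,\dots\}$ let ${}_2F_1(a,b;c;w)$ denote the principal branch of the Gauss hypergeometric function, i.e. the analytic continuation of $\sum_{k\ge 0}\frac{(a)_k(b)_k}{(c)_k\,k!}w^k$ from $|w|<1$ to $\mathbb{C}\setminus[1,\infty)$. Let $(a)_k=a(a+1)\cdots(a+k-1)$, let $\psi=\Gamma'/\Gamma$ be the digamma function, let $\log$ be the principal logarithm, and let $1/\Gamma$ be $0$ at the poles of $\Gamma$. (1) Let $\mu,\nu,\rho\in\mathbb{C}$ be such that $\nu-\rho$ is a positive integer, $\mathrm{Re}(\rho)>0$, $\rho\notin\mathbb{Z}$ and $\mathrm{Re}(\rho-\nu+\mu)>0$. Then the analytic continuation ${}_2F_1(\mu,\nu;\mu+\rho;\cdot)$ exists, and for all $z\neq 0$ with $|z|<1$ and $|\arg z|<\pi$, $$ \begin{aligned} {}_2F_1(\mu,\nu;\mu+\rho;1-z)={}&\frac{\Gamma(\mu+\rho)\Gamma(\nu-\rho)}{\Gamma(\mu)\Gamma(\nu)\,z^{\nu-\rho}}\sum_{k=0}^{\nu-\rho-1}\frac{(\rho)_k(\mu-\nu+\rho)_k}{(1-\nu+\rho)_k\,k!}z^k\\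 &-(-1)^{\nu-\rho}\frac{\Gamma(\mu+\rho)}{\Gamma(\rho)\Gamma(\nu-\rho+1)\Gamma(\mu-\nu+\rho)}\,{}_2F_1(\mu,\nu;\nu-\rho+1;z)\log z\\ &+(-1)^{\nu-\rho}\frac{\Gamma(\mu+\rho)}{\Gamma(\rho)\Gamma(\nu-\rho+1)\Gamma(\mu-\nu+\rho)}\sum_{k=0}^{\infty}\frac{(\mu)_k(\nu)_k}{(\nu-\rho+1)_k\,k!}\\ &\qquad\times\bigl[\psi(k+1)-\psi(k+\mu)+\psi(k+\nu+1-\rho)-\psi(k+\nu)\bigr]z^k , \end{aligned} $$ where the infinite series converges absolutely. (2) Let $n$ be a positive integer and let $\mu,\nu\in\mathbb{C}$ be such that none of $\mu$, $\nu$, $\mu+\nu-n$ lies in $\{0,-1,-2,\dots\}$. Then the analytic continuation ${}_2F_1(\mu,\nu;\mu+\nu-n;\cdot)$ exists, and for all $w\ne 1$ with $|1-w|<1$ and $|\arg(1-w)|<\pi$, $$ \begin{aligned} {}_2F_1(\mu,\nu;\mu+\nu-n;w)={}&\frac{\Gamma(\mu+\nu-n)\,(n-1)!}{\Gamma(\nu)\Gamma(\mu)}(1-w)^{-n}\sum_{k=0}^{n-1}\frac{(\nu-n)_k(\mu-n)_k}{(1-n)_k\,k!}(1-w)^k\\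 &+(-1)^n\frac{\Gamma(\mu+\nu-n)}{\Gamma(\nu-n)\Gamma(\mu-n)\,n!}\sum_{k=0}^{\infty}\frac{(\mu)_k(\nu)_k}{(n+1)_k\,k!}(1-w)^k\\ &\qquad\times\bigl[-\log(1-w)+\psi(k+1)+\psi(k+n+1)-\psi(k+\mu)-\psi(k+\nu)\bigr], \end{aligned} $$ where the infinite series converges absolutely. (3) The two transformations are equivalent: for $n,\mu,\nu,w$ as in (2), the right-hand side of the formula in (1), taken with $\rho=\nu-n$ and $z=1-w$, equals the right-hand side of the formula in (2). -/

import Mathlib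

open Complex

noncomputable section

/-- The plane cut along `[1, ∞)`, that is, `ℂ ∖ [1, ∞)`: the points `w` for which `1 - w` does not
lie on `(-∞, 0]`. -/
def cutPlane : Set ℂ := {w : ℂ | 1 - w ∈ slitPlane}

/-- `F` is the principal branch of the Gauss function with parameters `a, b; c`: it is holomorphic
on `ℂ ∖ [1, ∞)` and agrees with the Gauss series on the open unit disc. -/
structure IsGaussBranch (a b c : ℂ) (F : ℂ → ℂ) : Prop where
  differentiableOn : DifferentiableOn ℂ F cutPlane
  eqOn_ball : Set.EqOn F (₂F₁ a b c) (Metric.ball 0 1)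

theorem isOpen_cutPlane : IsOpen cutPlane :=
  isOpen_slitPlane.preimage (continuous_const.sub continuous_id)

theorem zero_mem_cutPlane : (0 : ℂ) ∈ cutPlane := by
  simp [cutPlane]

theorem isPreconnected_cutPlane : IsPreconnected cutPlane := by
  have h : cutPlane = (fun w : ℂ => 1 - w) '' slitPlane := by
    ext w
    constructor
    · intro hw
      exact ⟨1 - w, hw, by ring⟩
    · rintro ⟨v, hv, rfl⟩
      simpa [cutPlane] using hv
  rw [h]
  have hp : IsPreconnected slitPlane :=
    (starConvex_one_slitPlane.isPathConnected one_mem_slitPlane).isConnected.isPreconnected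
  exact hp.image _ (by fun_prop)

/-- The principal branch is determined on the whole cut plane by its defining properties. -/
theorem IsGaussBranch.unique {a b c : ℂ} {F G : ℂ → ℂ} (hF : IsGaussBranch a b c F)
    (hG : IsGaussBranch a b c G) : Set.EqOn F G cutPlane := by
  refine (hF.differentiableOn.analyticOnNhd isOpen_cutPlane).eqOn_of_preconnected_of_eventuallyEq
    (hG.differentiableOn.analyticOnNhd isOpen_cutPlane) isPreconnected_cutPlane
    zero_mem_cutPlane ?_
  filter_upwards [Metric.ball_mem_nhds (0 : ℂ) one_pos] with w hw
  rw [hF.eqOn_ball hw, hG.eqOn_ball hw]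

open Classical in
/-- The Gauss hypergeometric function on `ℂ ∖ [1, ∞)`: the principal branch, i.e. the analytic
continuation of the Gauss series from the unit disc to the cut plane. (Should there be no such
continuation, the value is that of the bare series; the theorem asserts that there is one.) -/
def gaussF (a b c : ℂ) : ℂ → ℂ :=
  if h : ∃ F : ℂ → ℂ, IsGaussBranch a b c F then h.choose else ₂F₁ a b c

/-- The Pochhammer symbol `(a)_k = a (a + 1) ⋯ (a + k - 1)`. -/
def poch (a : ℂ) (k : ℕ) : ℂ := (ascPochhammer ℂ k).eval a

/-- The `k`-th term of the power series with digamma coefficients, in the parameters `μ, ν, ρ`. -/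
def digammaTerm (μ ν ρ z : ℂ) (k : ℕ) : ℂ :=
  poch μ k * poch ν k / (poch (ν - ρ + 1) k * (k.factorial : ℂ)) *
    (digamma (k + 1) - digamma (k + μ) + digamma (k + ν + 1 - ρ) - digamma (k + ν)) * z ^ k

/-- The right-hand side of the representation of `₂F₁(μ, ν; μ + ρ; 1 - z)`,
where `n` is the positive integer `ν - ρ`. Inside the unit disc `₂F₁` is the Gauss series. -/
def reprRhs (μ ν ρ : ℂ) (n : ℕ) (z : ℂ) : ℂ :=
  Gamma (μ + ρ) * Gamma (ν - ρ) / (Gamma μ * Gamma ν * z ^ n) *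
      (∑ k ∈ Finset.range n,
        poch ρ k * poch (μ - ν + ρ) k / (poch (1 - ν + ρ) k * (k.factorial : ℂ)) * z ^ k)
    - (-1) ^ n * (Gamma (μ + ρ) / (Gamma ρ * Gamma (ν - ρ + 1) * Gamma (μ - ν + ρ))) *
        ₂F₁ μ ν (ν - ρ + 1) z * log z
    + (-1) ^ n * (Gamma (μ + ρ) / (Gamma ρ * Gamma (ν - ρ + 1) * Gamma (μ - ν + ρ))) *
        ∑' k : ℕ, digammaTerm μ ν ρ z k

/-- The `k`-th term of the infinite series in the logarithmic transformation
of `₂F₁(μ, ν; μ + ν - n; w)`. -/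
def logTerm (μ ν : ℂ) (n : ℕ) (w : ℂ) (k : ℕ) : ℂ :=
  poch μ k * poch ν k / (poch (n + 1) k * (k.factorial : ℂ)) * (1 - w) ^ k *
    (-log (1 - w) + digamma (k + 1) + digamma (k + n + 1) - digamma (k + μ) - digamma (k + ν))

/-- The right-hand side of the logarithmic transformation of `₂F₁(μ, ν; μ + ν - n; w)`. Where
`ν - n` or `μ - n` is a pole of the Gamma function, `1 / Γ` is `0` there, as it is in Mathlib. -/
def logRhs (μ ν : ℂ) (n : ℕ) (w : ℂ) : ℂ :=
  Gamma (μ + ν - n) * ((n - 1).factorial : ℂ) / (Gamma ν * Gamma μ * (1 - w) ^ n) *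
      (∑ k ∈ Finset.range n,
        poch (ν - n) k * poch (μ - n) k / (poch (1 - n) k * (k.factorial : ℂ)) * (1 - w) ^ k)
    + (-1) ^ n * (Gamma (μ + ν - n) / (Gamma (ν - n) * Gamma (μ - n) * (n.factorial : ℂ))) *
        ∑' k : ℕ, logTerm μ ν n w k

end

/-! The two formulas are rearrangements of one another, so everything rests on the expansion at `w =
1` of the normalised function `Γ(μ) Γ(ν) / Γ(c) ₂F₁(μ, ν; c; w)` with `c = μ + ν - n`. The predicate
`HasLogExpansion` packages the continuation to the cut plane together with this expansion, and is
proved in three stages.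

For `n = 0` and real parts of the parameters at least `2`, the Euler integral `eulerInt` supplies
the continuation. In `z = 1 - w` it satisfies the hypergeometric equation with third parameter `1`,
and so does the proposed expansion `p - q log z`. Both behave like `-log z + 2ψ(1) - ψ(a) - ψ(b)` as
`z → 0+`, so their difference is a solution tending to `0`. A Wronskian argument
(`eventually_eq_zero_of_hypergeometric_eq`) makes it vanish near `0`, and the identity theorem
carries the equality to the slit disc (`eulerInt_one_sub_eq`).

First-order differential operators then move the parameters. `HasLogExpansion.lower` replaces `a +
1` by `a` with `n = 0` kept, which reaches all admissible pairs. `HasLogExpansion.raise` applies `w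
d/dw + c`, which lowers the third parameter by one and so raises `n`. An operator preserves
holomorphy on the cut plane; its effect on the series at `0` and at `1` is a coefficient recurrence.

Finally `logRhs_eq` matches the coefficients with the stated formula, and uniqueness of the branch
identifies the continuation with `gaussF`. -/

/-! ### Power series converging on the unit disc -/

/-- The power series with coefficients `u` converges on the open unit disc. -/
def ConvOnDisc (u : ℕ → ℂ) : Prop := ∀ z : ℂ, ‖z‖ < 1 → Summable fun k => u k * z ^ k

/-- The sum of the power series with coefficients `u`. -/
noncomputable def psum (u : ℕ → ℂ) (z : ℂ) : ℂ := ∑' k, u k * z ^ k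

/-- Coefficients of `z ↦ z * psum u z`. -/
def coeffShift (u : ℕ → ℂ) : ℕ → ℂ
  | 0 => 0
  | k + 1 => u k

/-- Coefficients of the derivative of a power series. -/
def coeffDeriv (u : ℕ → ℂ) (k : ℕ) : ℂ := (k + 1) * u (k + 1)

theorem ConvOnDisc.hasSum {u : ℕ → ℂ} (hu : ConvOnDisc u) {z : ℂ} (hz : ‖z‖ < 1) :
    HasSum (fun k => u k * z ^ k) (psum u z) := (hu z hz).hasSum

/-- The terms at an intermediate radius `s` are bounded, so those at `r < s` are dominated by `(k +
1) (r / s) ^ k`. The spare linear factor pays for differentiation and for the growth of the digamma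
coefficients. -/
theorem ConvOnDisc.summable_mul_norm {u : ℕ → ℂ} (hu : ConvOnDisc u) {r : ℝ} (hr0 : 0 ≤ r)
    (hr : r < 1) : Summable fun k : ℕ => ((k : ℝ) + 1) * ‖u k‖ * r ^ k := by
  obtain ⟨s, hrs, hs⟩ := exists_between hr
  have hs0 : 0 < s := hr0.trans_lt hrs
  have hsum := hu (s : ℂ) (by simpa [abs_of_pos hs0] using hs)
  obtain ⟨M, hM⟩ := (Metric.isBounded_range_of_tendsto _ hsum.tendsto_atTop_zero).exists_norm_le
  have hM' : ∀ k, ‖u k‖ * s ^ k ≤ M := fun k => by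
    have := hM _ ⟨k, rfl⟩
    simpa [abs_of_pos hs0] using this
  have hq : ‖r / s‖ < 1 := by
    rw [Real.norm_of_nonneg (by positivity)]
    exact (div_lt_one hs0).2 hrs
  have h1 : Summable fun k : ℕ => ((k : ℝ) + 1) * (r / s) ^ k := by
    have := (summable_pow_mul_geometric_of_norm_lt_one 1 hq).add
      (summable_geometric_of_norm_lt_one hq)
    refine this.congr fun k => ?_
    simp only [pow_one]
    ring
  refine Summable.of_nonneg_of_le (fun k => by positivity) (fun k => ?_) (h1.mul_left M)
  calc ((k : ℝ) + 1) * ‖u k‖ * r ^ k = (‖u k‖ * s ^ k) * (((k : ℝ) + 1) * (r / s) ^ k) := by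
        rw [div_pow]
        field_simp
    _ ≤ M * (((k : ℝ) + 1) * (r / s) ^ k) := by
        gcongr
        exact hM' k

theorem ConvOnDisc.mul_of_norm_le {u e : ℕ → ℂ} (hu : ConvOnDisc u) {C : ℝ}
    (he : ∀ k, ‖e k‖ ≤ C * ((k : ℝ) + 1)) : ConvOnDisc fun k => u k * e k := by
  intro z hz
  refine Summable.of_norm_bounded ((hu.summable_mul_norm (norm_nonneg z) hz).mul_left C)
    fun k => ?_
  rw [norm_mul, norm_mul, norm_pow]
  calc ‖u k‖ * ‖e k‖ * ‖z‖ ^ k ≤ ‖u k‖ * (C * ((k : ℝ) + 1)) * ‖z‖ ^ k := by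
        gcongr
        exact he k
    _ = _ := by ring

theorem ConvOnDisc.natCast_mul {u : ℕ → ℂ} (hu : ConvOnDisc u) :
    ConvOnDisc fun k => (k : ℂ) * u k := by
  have := hu.mul_of_norm_le (e := fun k => (k : ℂ)) (C := 1) (fun k => by simp)
  simpa only [mul_comm] using this

theorem ConvOnDisc.coeffShift {u : ℕ → ℂ} (hu : ConvOnDisc u) : ConvOnDisc (coeffShift u) := by
  intro z hz
  rw [← summable_nat_add_iff 1]
  refine ((hu z hz).mul_left z).congr fun k => ?_
  simp only [_root_.coeffShift]
  ring

theorem ConvOnDisc.coeffDeriv {u : ℕ → ℂ} (hu : ConvOnDisc u) : ConvOnDisc (coeffDeriv u) := by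
  intro z hz
  by_cases h0 : z = 0
  · refine summable_of_ne_finset_zero (s := {0}) fun k hk => ?_
    have : k ≠ 0 := by simpa using hk
    simp [h0, this]
  · have h1 := (summable_nat_add_iff 1).2 (hu.natCast_mul z hz)
    refine (h1.mul_left z⁻¹).congr fun k => ?_
    simp only [_root_.coeffDeriv]
    push_cast
    field_simp
    ring

theorem ConvOnDisc.const_mul {u : ℕ → ℂ} (c : ℂ) (hu : ConvOnDisc u) :
    ConvOnDisc fun k => c * u k := fun z hz =>
  ((hu z hz).mul_left c).congr fun k => by ring

theorem psum_const_mul (c : ℂ) (u : ℕ → ℂ) (z : ℂ) :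
    psum (fun k => c * u k) z = c * psum u z := by
  rw [psum, psum, ← tsum_mul_left]
  exact tsum_congr fun k => by ring

theorem psum_coeffShift {u : ℕ → ℂ} (hu : ConvOnDisc u) {z : ℂ} (hz : ‖z‖ < 1) :
    psum (coeffShift u) z = z * psum u z := by
  rw [psum, (hu.coeffShift z hz).tsum_eq_zero_add, psum, ← tsum_mul_left]
  simp only [coeffShift, zero_mul, zero_add]
  exact tsum_congr fun k => by ring

theorem psum_natCast_mul {u : ℕ → ℂ} (hu : ConvOnDisc u) {z : ℂ} (hz : ‖z‖ < 1) :
    psum (fun k => (k : ℂ) * u k) z = z * psum (coeffDeriv u) z := by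
  rw [psum, (hu.natCast_mul z hz).tsum_eq_zero_add, psum, ← tsum_mul_left]
  simp only [coeffDeriv, Nat.cast_zero, zero_mul, zero_add]
  exact tsum_congr fun k => by push_cast; ring

theorem psum_zero (u : ℕ → ℂ) : psum u 0 = u 0 := by
  rw [psum, tsum_eq_single 0 fun k hk => by simp [hk]]
  simp

theorem ConvOnDisc.hasDerivAt {u : ℕ → ℂ} (hu : ConvOnDisc u) {z : ℂ} (hz : ‖z‖ < 1) :
    HasDerivAt (psum u) (psum (_root_.coeffDeriv u) z) z := by
  obtain ⟨r, hzr, hr⟩ := exists_between hz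
  have hr0 : 0 < r := (norm_nonneg z).trans_lt hzr
  have hb := (hu.coeffDeriv.summable_mul_norm hr0.le hr)
  have hsum : Summable fun k : ℕ => (k : ℝ) * ‖u k‖ * r ^ (k - 1) := by
    rw [← summable_nat_add_iff 1]
    refine Summable.of_nonneg_of_le (fun k => by positivity) (fun k => ?_) hb
    simp only [_root_.coeffDeriv, norm_mul]
    rw [show ‖(k : ℂ) + 1‖ = (k : ℝ) + 1 by exact_mod_cast Complex.norm_natCast (k + 1)]
    push_cast
    have : 0 ≤ (k : ℝ) * (((k : ℝ) + 1) * ‖u (k + 1)‖ * r ^ k) := by positivity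
    nlinarith
  have h := hasDerivAt_tsum_of_isPreconnected (t := Metric.ball (0 : ℂ) r)
    (g := fun k y => u k * y ^ k) (g' := fun k y => u k * (k * y ^ (k - 1))) hsum
    Metric.isOpen_ball (convex_ball _ _).isPreconnected
    (fun k y _ => (hasDerivAt_pow k y).const_mul (u k))
    (fun k y hy => by
      rw [norm_mul, norm_mul, norm_pow, Complex.norm_natCast, ← mul_assoc, mul_comm ‖u k‖]
      gcongr
      exact (mem_ball_zero_iff.1 hy).le)
    (y₀ := 0) (by simpa using hr0) (hu 0 (by simp)) (mem_ball_zero_iff.2 hzr)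
  refine h.congr_deriv ?_
  have hs : Summable fun k : ℕ => u k * (k * z ^ (k - 1)) := by
    refine Summable.of_norm_bounded hsum fun k => ?_
    rw [norm_mul, norm_mul, norm_pow, Complex.norm_natCast, ← mul_assoc, mul_comm ‖u k‖]
    gcongr
  rw [hs.tsum_eq_zero_add, psum]
  simp only [_root_.coeffDeriv, Nat.cast_zero, zero_mul, mul_zero, zero_add, Nat.add_sub_cancel]
  exact tsum_congr fun k => by push_cast; ring

theorem ConvOnDisc.differentiableOn {u : ℕ → ℂ} (hu : ConvOnDisc u) :
    DifferentiableOn ℂ (psum u) (Metric.ball 0 1) := fun _ hz =>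
  (hu.hasDerivAt (mem_ball_zero_iff.1 hz)).differentiableAt.differentiableWithinAt

theorem ConvOnDisc.continuousAt {u : ℕ → ℂ} (hu : ConvOnDisc u) {z : ℂ} (hz : ‖z‖ < 1) :
    ContinuousAt (psum u) z := (hu.hasDerivAt hz).continuousAt

/-- Coefficients with `u (k + 1) / u k → 1` give a series convergent on the unit disc. -/
theorem ConvOnDisc.of_ratio {u r : ℕ → ℂ} (h : ∀ k, u (k + 1) = r k * u k)
    (hr : Filter.Tendsto r Filter.atTop (nhds 1)) : ConvOnDisc u := by
  intro z hz
  obtain ⟨s, hzs, hs⟩ := exists_between hz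
  refine summable_of_ratio_norm_eventually_le hs ?_
  have h1 : Filter.Tendsto (fun k => ‖r k‖ * ‖z‖) Filter.atTop (nhds (‖(1 : ℂ)‖ * ‖z‖)) :=
    (hr.norm).mul_const _
  rw [norm_one, one_mul] at h1
  filter_upwards [h1.eventually_le_const hzs] with k hk
  rw [h, pow_succ]
  simp only [norm_mul, norm_pow]
  calc ‖r k‖ * ‖u k‖ * (‖z‖ ^ k * ‖z‖) = (‖r k‖ * ‖z‖) * (‖u k‖ * ‖z‖ ^ k) := by ring
    _ ≤ s * (‖u k‖ * ‖z‖ ^ k) := by gcongr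

/-! ### Uniqueness for the hypergeometric equation at a logarithmic singular point -/

open Filter Topology in
/-- A function with a finite limit at `0+` cannot have a derivative of order exactly `1 / x`. -/
theorem eq_zero_of_tendsto_mul_deriv {v v' : ℝ → ℂ} {κ : ℂ}
    (hv : ∀ᶠ x in 𝓝[>] (0 : ℝ), HasDerivAt v (v' x) x)
    (hv' : Tendsto (fun x : ℝ => (x : ℂ) * v' x) (𝓝[>] 0) (𝓝 κ))
    (h0 : Tendsto v (𝓝[>] 0) (𝓝 0)) : κ = 0 := by
  have key : ∀ ε > 0, ‖κ * (Real.log 2 : ℝ)‖ ≤ ε := by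
    intro ε hε
    have h1 : ∀ᶠ x in 𝓝[>] (0 : ℝ), HasDerivAt v (v' x) x ∧ ‖(x : ℂ) * v' x - κ‖ ≤ ε :=
      hv.and ((tendsto_iff_norm_sub_tendsto_zero.1 hv').eventually_le_const hε)
    obtain ⟨δ, hδ, hδ'⟩ := mem_nhdsGT_iff_exists_Ioo_subset.1 h1
    have hδ0 : (0 : ℝ) < δ := hδ
    -- Mean value inequality for `v - κ log` on `[x, 2x]`: the derivative is at most `ε / y ≤ ε / x`
    -- and the interval has length `x`, so the bound `ε` does not depend on `x`. Letting `x → 0`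
    -- removes the `v` terms and leaves `κ log 2`.
    have h2 : ∀ᶠ x in 𝓝[>] (0 : ℝ), ‖v (2 * x) - v x - κ * (Real.log 2 : ℝ)‖ ≤ ε := by
      filter_upwards [Ioo_mem_nhdsGT (show (0 : ℝ) < δ / 2 by linarith)] with x hx
      have hx0 : 0 < x := hx.1
      have := (convex_Icc x (2 * x)).norm_image_sub_le_of_norm_hasDerivWithin_le
        (f := fun y : ℝ => v y - κ * (Real.log y : ℝ))
        (f' := fun y : ℝ => v' y - κ * ((y⁻¹ : ℝ) : ℂ)) (C := ε / x) (x := x) (y := 2 * x)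
        (fun y hy => by
          have hy0 : 0 < y := hx0.trans_le hy.1
          have hm : y ∈ Set.Ioo 0 δ := ⟨hy0, by linarith [hy.2, hx.2]⟩
          exact ((hδ' hm).1.sub
            ((Real.hasDerivAt_log hy0.ne').ofReal_comp.const_mul κ)).hasDerivWithinAt)
        (fun y hy => by
          have hy0 : 0 < y := hx0.trans_le hy.1
          have hyc : (y : ℂ) ≠ 0 := by exact_mod_cast hy0.ne'
          have hm : y ∈ Set.Ioo 0 δ := ⟨hy0, by linarith [hy.2, hx.2]⟩
          have e : v' y - κ * ((y⁻¹ : ℝ) : ℂ) = ((y : ℂ) * v' y - κ) / y := by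
            push_cast
            field_simp
          rw [e, norm_div, Complex.norm_of_nonneg hy0.le]
          exact div_le_div₀ hε.le (hδ' hm).2 hx0 hy.1)
        ⟨le_rfl, by linarith⟩ ⟨by linarith, le_rfl⟩
      have e1 : ‖2 * x - x‖ = x := by
        rw [Real.norm_of_nonneg] <;> linarith
      rw [e1, div_mul_cancel₀ _ hx0.ne', Real.log_mul two_ne_zero hx0.ne'] at this
      refine le_trans (le_of_eq ?_) this
      congr 1
      push_cast
      ring
    have h3 : Tendsto (fun x : ℝ => ‖v (2 * x) - v x - κ * (Real.log 2 : ℝ)‖) (𝓝[>] 0)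
        (𝓝 ‖(0 : ℂ) - 0 - κ * (Real.log 2 : ℝ)‖) := by
      refine (((h0.comp ?_).sub h0).sub_const _).norm
      refine tendsto_nhdsWithin_iff.2 ⟨?_, ?_⟩
      · have : Tendsto (fun x : ℝ => 2 * x) (𝓝 0) (𝓝 (2 * 0)) := tendsto_id.const_mul 2
        rw [mul_zero] at this
        exact this.mono_left nhdsWithin_le_nhds
      · filter_upwards [self_mem_nhdsWithin] with x hx
        exact mul_pos two_pos (Set.mem_Ioi.1 hx)
    have h4 := le_of_tendsto h3 h2
    simpa only [sub_zero, zero_sub, norm_neg] using h4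
  have h5 : ‖κ * (Real.log 2 : ℝ)‖ = 0 :=
    le_antisymm (le_of_forall_pos_le_add fun ε hε => by simpa using key ε hε) (norm_nonneg _)
  rw [norm_eq_zero, mul_eq_zero] at h5
  refine h5.resolve_right ?_
  exact_mod_cast (Real.log_pos one_lt_two).ne'

open Filter Topology in
/-- A solution of `x (1 - x) y'' + (1 - (s + 1) x) y' - m y = 0` which tends to `0` at the
singular point `0` vanishes near `0`, as there is a solution with a nonzero limit. -/
theorem eventually_eq_zero_of_hypergeometric_eq {s m : ℂ} {y y' y'' g g' g'' : ℝ → ℂ}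
    (hy : ∀ x ∈ Set.Ioo (0 : ℝ) 1, HasDerivAt y (y' x) x)
    (hy' : ∀ x ∈ Set.Ioo (0 : ℝ) 1, HasDerivAt y' (y'' x) x)
    (ey : ∀ x ∈ Set.Ioo (0 : ℝ) 1,
      (x : ℂ) * (1 - x) * y'' x + (1 - (s + 1) * x) * y' x - m * y x = 0)
    (hg : ∀ x ∈ Set.Ioo (0 : ℝ) 1, HasDerivAt g (g' x) x)
    (hg' : ∀ x ∈ Set.Ioo (0 : ℝ) 1, HasDerivAt g' (g'' x) x)
    (eg : ∀ x ∈ Set.Ioo (0 : ℝ) 1,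
      (x : ℂ) * (1 - x) * g'' x + (1 - (s + 1) * x) * g' x - m * g x = 0)
    (y0 : Tendsto y (𝓝[>] 0) (𝓝 0)) (g0 : Tendsto g (𝓝[>] 0) (𝓝 1)) :
    ∀ᶠ x in 𝓝[>] (0 : ℝ), y x = 0 := by
  -- The integrating factor: `p' / p = (1 - (s + 1) x) / (x (1 - x))`, so by Abel's identity `p`
  -- times the Wronskian of `y` and `g` is a constant `κ`.
  set p : ℝ → ℂ := fun x => (x : ℂ) * (1 - (x : ℂ)) ^ s with hp
  have hsl : ∀ x ∈ Set.Ioo (0 : ℝ) 1, (1 - (x : ℂ)) ∈ slitPlane := fun x hx => by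
    left
    simpa using hx.2
  have hpd : ∀ x ∈ Set.Ioo (0 : ℝ) 1, HasDerivAt p
      ((1 - (x : ℂ)) ^ s + x * (s * (1 - (x : ℂ)) ^ (s - 1) * (-1))) x := fun x hx => by
    have h1 : HasDerivAt (fun w : ℂ => w * (1 - w) ^ s)
        (1 * (1 - (x : ℂ)) ^ s + x * (s * (1 - (x : ℂ)) ^ (s - 1) * (-1))) (x : ℂ) :=
      (hasDerivAt_id _).mul (((hasDerivAt_id _).const_sub 1).cpow_const (hsl x hx))
    rw [one_mul] at h1
    exact h1.comp_ofReal
  have hW : ∀ x ∈ Set.Ioo (0 : ℝ) 1,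
      HasDerivAt (fun x => p x * (y' x * g x - y x * g' x)) 0 x := fun x hx => by
    have h1 := (hpd x hx).mul (((hy' x hx).mul (hg x hx)).sub ((hy x hx).mul (hg' x hx)))
    refine h1.congr_deriv ?_
    have hne : (1 - (x : ℂ)) ≠ 0 := slitPlane_ne_zero (hsl x hx)
    rw [cpow_sub _ _ hne, cpow_one]
    simp only [hp, Pi.sub_apply, Pi.mul_apply]
    have e1 := ey x hx
    have e2 := eg x hx
    have e3 : (x : ℂ) * (1 - x) * (y'' x * g x - y x * g'' x)
        = -(1 - (s + 1) * x) * (y' x * g x - y x * g' x) := by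
      linear_combination g x * e1 - y x * e2
    field_simp
    linear_combination (1 - (x : ℂ)) ^ s * e3
  obtain ⟨κ, hκ⟩ : ∃ κ, ∀ x ∈ Set.Ioo (0 : ℝ) 1, p x * (y' x * g x - y x * g' x) = κ :=
    ⟨_, fun x hx => (convex_Ioo (0 : ℝ) 1).is_const_of_fderivWithin_eq_zero (𝕜 := ℝ)
      (fun z hz => (hW z hz).differentiableAt.differentiableWithinAt)
      (fun z hz => by
        rw [fderivWithin_of_isOpen isOpen_Ioo hz]
        have := (hW z hz).hasFDerivAt.fderiv
        rw [this]
        ext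
        simp) hx (show (1 / 2 : ℝ) ∈ Set.Ioo (0 : ℝ) 1 by constructor <;> norm_num)⟩
  have hmem : ∀ᶠ x in 𝓝[>] (0 : ℝ), x ∈ Set.Ioo (0 : ℝ) 1 := Ioo_mem_nhdsGT one_pos
  have hgne : ∀ᶠ x in 𝓝[>] (0 : ℝ), g x ≠ 0 := g0.eventually_ne one_ne_zero
  have hpow : Tendsto (fun x : ℝ => (1 - (x : ℂ)) ^ s) (𝓝[>] 0) (𝓝 1) := by
    have h1 : ContinuousAt (fun x : ℝ => (1 - (x : ℂ)) ^ s) 0 := by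
      exact ContinuousAt.cpow (by fun_prop) continuousAt_const (by simp)
    have h2 := h1.tendsto.mono_left (nhdsWithin_le_nhds (s := Set.Ioi 0))
    simpa using h2
  have hderiv : ∀ x ∈ Set.Ioo (0 : ℝ) 1, g x ≠ 0 → HasDerivAt (fun x => y x / g x)
      (κ / (p x * g x ^ 2)) x := fun x hx hgx => by
    refine ((hy x hx).div (hg x hx) hgx).congr_deriv ?_
    have hx0 : (x : ℂ) ≠ 0 := by exact_mod_cast hx.1.ne'
    have hpx : p x ≠ 0 := mul_ne_zero hx0 (by
      rw [Ne, cpow_eq_zero_iff]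
      exact fun h => slitPlane_ne_zero (hsl x hx) h.1)
    rw [← hκ x hx]
    field_simp
  have hv0 : Tendsto (fun x => y x / g x) (𝓝[>] 0) (𝓝 0) := by
    have h1 := y0.div g0 one_ne_zero
    rw [zero_div] at h1
    exact h1
  -- The derivative of `y / g` is `κ / (p g²)`, which is asymptotic to `κ / x`; since `y / g` has a
  -- finite limit, `κ` must vanish.
  have hκ0 : κ = 0 := by
    refine eq_zero_of_tendsto_mul_deriv (v := fun x => y x / g x)
      (v' := fun x => κ / (p x * g x ^ 2)) ?_ ?_ hv0
    · filter_upwards [hmem, hgne] with x hx hgx using hderiv x hx hgx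
    · have h1 : Tendsto (fun x : ℝ => κ / ((1 - (x : ℂ)) ^ s * g x ^ 2)) (𝓝[>] 0)
          (𝓝 (κ / (1 * 1 ^ 2))) := tendsto_const_nhds.div (hpow.mul (g0.pow 2)) (by simp)
      simp only [one_pow, mul_one, div_one] at h1
      refine h1.congr' ?_
      filter_upwards [hmem] with x hx
      have hx0 : (x : ℂ) ≠ 0 := by exact_mod_cast hx.1.ne'
      simp only [hp]
      field_simp
  obtain ⟨δ, hδ, hδ'⟩ := mem_nhdsGT_iff_exists_Ioo_subset.1 (hmem.and hgne)
  have hδ0 : (0 : ℝ) < δ := hδ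
  have hconst : ∀ a ∈ Set.Ioo 0 δ, ∀ b ∈ Set.Ioo 0 δ, y a / g a = y b / g b := fun a ha b hb => by
    have hd : ∀ z ∈ Set.Ioo 0 δ, HasDerivAt (fun x => y x / g x) 0 z := fun z hz => by
      have := hderiv z (hδ' hz).1 (hδ' hz).2
      rwa [hκ0, zero_div] at this
    have := (convex_Ioo (0 : ℝ) δ).norm_image_sub_le_of_norm_hasDerivWithin_le (C := 0)
      (fun z hz => (hd z hz).hasDerivWithinAt) (fun z _ => by simp) hb ha
    rw [zero_mul] at this
    exact sub_eq_zero.1 (norm_le_zero_iff.1 this)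
  have hI : Set.Ioo 0 δ ∈ 𝓝[>] (0 : ℝ) := Ioo_mem_nhdsGT hδ0
  filter_upwards [hI] with x hx
  have h1 : Tendsto (fun x => y x / g x) (𝓝[>] 0) (𝓝 (y x / g x)) :=
    tendsto_const_nhds.congr' (by filter_upwards [hI] with b hb using hconst x hx b hb)
  have h2 := tendsto_nhds_unique h1 hv0
  exact (div_eq_zero_iff.1 h2).resolve_right (hδ' hx).2

/-! ### Pochhammer symbols and the Gauss series -/

theorem poch_zero (a : ℂ) : poch a 0 = 1 := by simp [poch]

theorem poch_succ (a : ℂ) (k : ℕ) : poch a (k + 1) = poch a k * (a + k) := by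
  simp [poch, ascPochhammer_succ_eval]

theorem poch_succ_left (a : ℂ) (k : ℕ) : poch a (k + 1) = a * poch (a + 1) k := by
  simp [poch, ascPochhammer_succ_left]

theorem poch_one (k : ℕ) : poch 1 k = k.factorial := by
  induction k with
  | zero => simp [poch_zero]
  | succ k ih =>
    rw [poch_succ, ih, Nat.factorial_succ]
    push_cast
    ring

theorem poch_add (a : ℂ) (m k : ℕ) : poch a (m + k) = poch a m * poch (a + m) k := by
  induction k with
  | zero => simp [poch_zero]
  | succ k ih =>
    rw [← add_assoc, poch_succ, ih, poch_succ]
    push_cast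
    ring

theorem add_natCast_ne_zero {a : ℂ} (ha : ∀ m : ℕ, a ≠ -m) (k : ℕ) : a + k ≠ 0 := fun h =>
  ha k (eq_neg_of_add_eq_zero_left h)

theorem ne_neg_natCast_add {a : ℂ} (ha : ∀ m : ℕ, a ≠ -m) (n : ℕ) : ∀ m : ℕ, a + n ≠ -m :=
  fun m h => ha (n + m) (by push_cast; linear_combination h)

theorem ne_neg_natCast_of_re_pos {a : ℂ} (ha : 0 < a.re) : ∀ m : ℕ, a ≠ -m := fun m h => by
  rw [h] at ha
  simp only [neg_re, natCast_re] at ha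
  linarith [m.cast_nonneg (α := ℝ)]

theorem poch_ne_zero {a : ℂ} (ha : ∀ m : ℕ, a ≠ -m) (k : ℕ) : poch a k ≠ 0 := by
  induction k with
  | zero => simp [poch_zero]
  | succ k ih =>
    rw [poch_succ]
    exact mul_ne_zero ih (add_natCast_ne_zero ha k)

theorem Gamma_add_natCast {a : ℂ} (ha : ∀ m : ℕ, a ≠ -m) (k : ℕ) :
    Gamma (a + k) = poch a k * Gamma a := by
  rw [poch, ← Gamma_add_nat_div_Gamma_eq a ha, div_mul_cancel₀ _ (Gamma_ne_zero ha)]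

open Filter Topology in
theorem tendsto_add_natCast_div (a b : ℂ) :
    Tendsto (fun k : ℕ => (a + k) / (b + k)) atTop (𝓝 1) := by
  have h0 : ∀ c : ℂ, Tendsto (fun k : ℕ => c / (k : ℂ) + 1) atTop (𝓝 1) := fun c => by
    simpa using (tendsto_const_div_atTop_nhds_zero_nat c).add_const 1
  have h := (h0 a).div (h0 b) one_ne_zero
  rw [div_one] at h
  refine h.congr' ?_
  filter_upwards [eventually_gt_atTop 0] with k hk
  have hk' : (k : ℂ) ≠ 0 := by exact_mod_cast hk.ne'
  simp only [Pi.div_apply]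
  rw [div_add_one hk', div_add_one hk', div_div_div_cancel_right₀ hk']

/-- The coefficients of the Gauss series, normalised by the factor `Γ(a) Γ(b) / Γ(c)`. -/
noncomputable def gaussCoeff (a b c : ℂ) (k : ℕ) : ℂ :=
  Gamma a * Gamma b / Gamma c * (poch a k * poch b k / (poch c k * k.factorial))

theorem gaussCoeff_symm (a b c : ℂ) : gaussCoeff a b c = gaussCoeff b a c := by
  funext k
  simp only [gaussCoeff]
  ring

theorem convOnDisc_poch_div (a b c d : ℂ) :
    ConvOnDisc fun k => poch a k * poch b k / (poch c k * poch d k) := by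
  refine ConvOnDisc.of_ratio (r := fun k => (a + k) / (c + k) * ((b + k) / (d + k)))
    (fun k => ?_) ?_
  · simp only [poch_succ, div_eq_mul_inv, mul_inv]
    ring
  · simpa using (tendsto_add_natCast_div a c).mul (tendsto_add_natCast_div b d)

theorem convOnDisc_gaussCoeff (a b c : ℂ) : ConvOnDisc (gaussCoeff a b c) := by
  have := (convOnDisc_poch_div a b c 1).const_mul (Gamma a * Gamma b / Gamma c)
  simp only [poch_one] at this
  exact this

theorem psum_gaussCoeff (a b c w : ℂ) :
    psum (gaussCoeff a b c) w = Gamma a * Gamma b / Gamma c * ₂F₁ a b c w := by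
  rw [psum, ordinaryHypergeometric_eq_tsum, ← tsum_mul_left]
  refine tsum_congr fun k => ?_
  simp only [gaussCoeff, poch, smul_eq_mul, div_eq_mul_inv, mul_inv]
  ring

/-! ### The Euler integral -/

/-- The binomial series with complex exponent. -/
theorem hasSum_one_sub_cpow_neg (a : ℂ) {x : ℂ} (hx : ‖x‖ < 1) :
    HasSum (fun k : ℕ => poch a k / k.factorial * x ^ k) ((1 - x) ^ (-a)) := by
  have hx' : x ∈ Metric.eball (0 : ℂ) 1 := by
    rw [← ENNReal.ofReal_one, Metric.eball_ofReal]
    exact mem_ball_zero_iff.2 hx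
  have h := (one_div_one_sub_cpow_hasFPowerSeriesOnBall_zero a).hasSum hx'
  rw [zero_add] at h
  have e : (fun k : ℕ => poch a k / k.factorial * x ^ k) = fun k =>
      FormalMultilinearSeries.ofScalars ℂ (fun n : ℕ => Ring.choose (a + n - 1) n) k
        fun _ => x := by
    funext k
    rw [FormalMultilinearSeries.ofScalars_apply_eq, smul_eq_mul]
    congr 1
    have h1 := Ring.factorial_nsmul_multichoose_eq_ascPochhammer a k
    rw [Polynomial.ascPochhammer_smeval_eq_eval, nsmul_eq_mul] at h1
    rw [Ring.choose, show a + k - 1 - k + 1 = a by ring, poch, ← h1,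
      mul_div_cancel_left₀ _ (by exact_mod_cast k.factorial_ne_zero)]
  rw [e, cpow_neg, ← one_div]
  exact h

/-- The Euler integral of the zero-balanced Gauss function. -/
noncomputable def eulerInt (a b w : ℂ) : ℂ :=
  ∫ t in (0 : ℝ)..1, (t : ℂ) ^ (b - 1) * (1 - (t : ℂ)) ^ (a - 1) * (1 - w * t) ^ (-a)

/-- The slit plane is star-shaped about `1`, and `1 - w t` lies on the segment from `1` to `1 - w`.
This keeps the integrand of the Euler integral on the principal branch. -/
theorem one_sub_mul_mem_slitPlane {w : ℂ} (hw : w ∈ cutPlane) {t : ℝ} (ht : t ∈ Set.Icc (0 : ℝ) 1) :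
    1 - w * t ∈ slitPlane := by
  have h1 : 1 - w ∈ slitPlane := hw
  have h := starConvex_one_slitPlane h1 (sub_nonneg.2 ht.2) ht.1 (by ring)
  convert h using 1
  simp only [real_smul]
  push_cast
  ring

theorem continuousOn_one_sub_mul_cpow (s : ℂ) :
    ContinuousOn (fun p : ℂ × ℝ => (1 - p.1 * p.2) ^ s) (cutPlane ×ˢ Set.Icc (0 : ℝ) 1) := by
  refine ContinuousOn.cpow (by fun_prop) continuousOn_const fun p hp => ?_
  exact one_sub_mul_mem_slitPlane hp.1 hp.2

theorem continuousOn_one_sub_mul_cpow_right {w : ℂ} (hw : w ∈ cutPlane) (s : ℂ) :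
    ContinuousOn (fun t : ℝ => (1 - w * t) ^ s) (Set.Icc (0 : ℝ) 1) := by
  refine ContinuousOn.cpow (by fun_prop) continuousOn_const fun t ht => ?_
  exact one_sub_mul_mem_slitPlane hw ht

theorem differentiableOn_eulerInt {a b : ℂ} (ha : 0 < a.re) (hb : 0 < b.re) :
    DifferentiableOn ℂ (eulerInt a b) cutPlane := by
  intro w hw
  refine DifferentiableAt.differentiableWithinAt ?_
  obtain ⟨r, hr, hball⟩ := Metric.nhds_basis_closedBall.mem_iff.1 (isOpen_cutPlane.mem_nhds hw)
  have hφ := betaIntegral_convergent hb ha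
  set φ : ℝ → ℂ := fun t => (t : ℂ) ^ (b - 1) * (1 - (t : ℂ)) ^ (a - 1) with hφdef
  have hIoc : Set.uIoc (0 : ℝ) 1 = Set.Ioc 0 1 := Set.uIoc_of_le zero_le_one
  have hK : ContinuousOn (fun p : ℂ × ℝ => a * p.2 * (1 - p.1 * p.2) ^ (-a - 1))
      (Metric.closedBall w r ×ˢ Set.Icc (0 : ℝ) 1) := by
    refine ContinuousOn.mul (by fun_prop) ?_
    exact (continuousOn_one_sub_mul_cpow _).mono (Set.prod_mono hball le_rfl)
  -- Only the beta kernel `φ` is singular at the endpoints. The `w`-derivative of the other factor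
  -- is continuous on a compact set, so `‖φ‖ M` is an integrable majorant.
  obtain ⟨M, hM⟩ := ((isCompact_closedBall w r).prod isCompact_Icc).exists_bound_of_continuousOn hK
  have hmeas : ∀ x ∈ cutPlane, ∀ s : ℂ, MeasureTheory.AEStronglyMeasurable
      (fun t : ℝ => (1 - x * t) ^ s) (MeasureTheory.volume.restrict (Set.uIoc (0 : ℝ) 1)) :=
    fun x hx s => by
      rw [hIoc]
      exact ((continuousOn_one_sub_mul_cpow_right hx s).mono
        Set.Ioc_subset_Icc_self).aestronglyMeasurable measurableSet_Ioc
  have hφm : MeasureTheory.AEStronglyMeasurable φ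
      (MeasureTheory.volume.restrict (Set.uIoc (0 : ℝ) 1)) := by
    rw [hIoc]
    exact hφ.1.aestronglyMeasurable
  have := intervalIntegral.hasDerivAt_integral_of_dominated_loc_of_deriv_le
    (μ := MeasureTheory.volume) (a := 0) (b := 1) (x₀ := w) (s := Metric.ball w r)
    (F := fun x (t : ℝ) => φ t * (1 - x * t) ^ (-a))
    (F' := fun x (t : ℝ) => φ t * (a * t * (1 - x * t) ^ (-a - 1)))
    (bound := fun t => ‖φ t‖ * M) (Metric.ball_mem_nhds w hr) ?_ ?_ ?_ ?_ ?_ ?_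
  · exact this.2.differentiableAt
  · filter_upwards [isOpen_cutPlane.mem_nhds hw] with x hx
    exact hφm.mul (hmeas x hx _)
  · refine hφ.mul_continuousOn ?_
    rw [Set.uIcc_of_le zero_le_one]
    exact continuousOn_one_sub_mul_cpow_right hw _
  · refine hφm.mul (MeasureTheory.AEStronglyMeasurable.mul ?_ (hmeas w hw _))
    exact (Continuous.aestronglyMeasurable (by fun_prop))
  · refine Filter.Eventually.of_forall fun t ht x hx => ?_
    rw [hIoc] at ht
    rw [norm_mul]
    gcongr
    exact hM (x, t) ⟨Metric.ball_subset_closedBall hx, Set.Ioc_subset_Icc_self ht⟩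
  · exact hφ.norm.mul_const M
  · refine Filter.Eventually.of_forall fun t ht x hx => ?_
    rw [hIoc] at ht
    have hs : 1 - x * t ∈ slitPlane := one_sub_mul_mem_slitPlane
      (hball (Metric.ball_subset_closedBall hx)) (Set.Ioc_subset_Icc_self ht)
    have h1 : HasDerivAt (fun x : ℂ => 1 - x * t) (-(1 * (t : ℂ))) x :=
      ((hasDerivAt_id x).mul_const (t : ℂ)).const_sub 1
    refine ((h1.cpow_const hs).const_mul (φ t)).congr_deriv ?_
    ring

theorem hasSum_eulerInt {a b : ℂ} (ha : 0 < a.re) (hb : 0 < b.re) {w : ℂ} (hw : ‖w‖ < 1) :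
    HasSum (fun k => gaussCoeff a b (a + b) k * w ^ k) (eulerInt a b w) := by
  have hφ := betaIntegral_convergent hb ha
  set φ : ℝ → ℂ := fun t => (t : ℂ) ^ (b - 1) * (1 - (t : ℂ)) ^ (a - 1) with hφdef
  have hIoc : Set.uIoc (0 : ℝ) 1 = Set.Ioc 0 1 := Set.uIoc_of_le zero_le_one
  have hφm : MeasureTheory.AEStronglyMeasurable φ
      (MeasureTheory.volume.restrict (Set.uIoc (0 : ℝ) 1)) := by
    rw [hIoc]
    exact hφ.1.aestronglyMeasurable
  have hs : Summable fun k : ℕ => ‖poch a k / k.factorial * w ^ k‖ :=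
    (hasSum_one_sub_cpow_neg a hw).summable.norm
  have h := intervalIntegral.hasSum_integral_of_dominated_convergence
    (μ := MeasureTheory.volume) (a := 0) (b := 1)
    (F := fun (k : ℕ) (t : ℝ) => φ t * (poch a k / k.factorial * (w * t) ^ k))
    (f := fun t : ℝ => φ t * (1 - w * t) ^ (-a))
    (fun k t => ‖φ t‖ * ‖poch a k / k.factorial * w ^ k‖) ?_ ?_ ?_ ?_ ?_
  · have e : (fun k => gaussCoeff a b (a + b) k * w ^ k) = fun k : ℕ =>
        ∫ t in (0 : ℝ)..1, φ t * (poch a k / k.factorial * (w * t) ^ k) := by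
      funext k
      have e1 : ∫ t in (0 : ℝ)..1, φ t * (poch a k / k.factorial * (w * t) ^ k)
          = ∫ t in (0 : ℝ)..1, poch a k / k.factorial * w ^ k *
            ((t : ℂ) ^ (b + k - 1) * (1 - (t : ℂ)) ^ (a - 1)) := by
        rw [intervalIntegral.integral_of_le zero_le_one, intervalIntegral.integral_of_le zero_le_one]
        refine MeasureTheory.setIntegral_congr_fun measurableSet_Ioc fun t ht => ?_
        have ht0 : (t : ℂ) ≠ 0 := by exact_mod_cast ht.1.ne'
        simp only [hφdef]
        rw [show b + k - 1 = b - 1 + k by ring, cpow_add _ _ ht0, cpow_natCast, mul_pow]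
        ring
      have hbk : 0 < (b + k).re := by
        simp only [add_re, natCast_re]
        positivity
      have hab : 0 < (a + b).re := by
        rw [add_re]
        positivity
      -- Each term of the binomial series of `(1 - w t) ^ (-a)` integrates to the beta value `B(b +
      -- k, a)`.
      rw [e1, intervalIntegral.integral_const_mul, ← betaIntegral,
        betaIntegral_eq_Gamma_mul_div _ _ hbk ha, show b + k + a = a + b + k by ring,
        Gamma_add_natCast (ne_neg_natCast_of_re_pos hb),
        Gamma_add_natCast (ne_neg_natCast_of_re_pos hab), gaussCoeff]
      simp only [div_eq_mul_inv, mul_inv]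
      ring
    rw [e]
    exact h
  · intro k
    exact hφm.mul (Continuous.aestronglyMeasurable (by fun_prop))
  · refine fun k => Filter.Eventually.of_forall fun t ht => ?_
    rw [hIoc] at ht
    simp only [norm_mul, norm_pow, Complex.norm_of_nonneg ht.1.le]
    gcongr
    · exact mul_nonneg (norm_nonneg w) ht.1.le
    · exact mul_le_of_le_one_right (norm_nonneg w) ht.2
  · exact Filter.Eventually.of_forall fun t _ => hs.mul_left _
  · simp only [tsum_mul_left]
    exact hφ.norm.mul_const _
  · refine Filter.Eventually.of_forall fun t ht => ?_
    rw [hIoc] at ht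
    refine (hasSum_one_sub_cpow_neg a ?_).mul_left _
    rw [norm_mul, Complex.norm_of_nonneg ht.1.le]
    exact (mul_le_of_le_one_right (norm_nonneg w) ht.2).trans_lt hw

/-! ### Behaviour of the Euler integral at the singular point `1` -/

/-- Once `1 ≤ Re s`, the derivative `s t ^ (s - 1)` is bounded by `‖s‖` on `(0, 1]`. The resulting
factor `1 - t` cancels the singularity at `t = 1` in the integrals below; this is where real parts
at least `2` are needed. -/
theorem norm_cpow_sub_one_le {s : ℂ} (hs : 1 ≤ s.re) {t : ℝ} (ht : t ∈ Set.Icc (0 : ℝ) 1) :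
    ‖(t : ℂ) ^ s - 1‖ ≤ ‖s‖ * (1 - t) := by
  have hs0 : s ≠ 0 := fun h => by norm_num [h] at hs
  rcases ht.1.eq_or_lt with rfl | ht0
  · simp only [ofReal_zero, zero_cpow hs0, zero_sub, norm_neg, norm_one, sub_zero, mul_one]
    exact hs.trans (re_le_norm s)
  have h := (convex_Icc t 1).norm_image_sub_le_of_norm_hasDerivWithin_le
    (f := fun x : ℝ => (x : ℂ) ^ s) (f' := fun x : ℝ => s * (x : ℂ) ^ (s - 1)) (C := ‖s‖)
    (x := 1) (y := t)
    (fun x hx => by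
      have hx0 : 0 < x := ht0.trans_le hx.1
      have h1 : HasDerivAt (fun z : ℂ => z ^ s) (s * (x : ℂ) ^ (s - 1) * 1) (x : ℂ) :=
        (hasDerivAt_id _).cpow_const (Or.inl (by simpa using hx0))
      rw [mul_one] at h1
      exact h1.comp_ofReal.hasDerivWithinAt)
    (fun x hx => by
      have hx0 : 0 < x := ht0.trans_le hx.1
      rw [norm_mul, norm_cpow_eq_rpow_re_of_pos hx0]
      refine mul_le_of_le_one_right (norm_nonneg s) (Real.rpow_le_one hx0.le hx.2 ?_)
      rw [sub_re, one_re]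
      linarith)
    ⟨ht.2, le_rfl⟩ ⟨le_rfl, ht.2⟩
  rw [Real.norm_of_nonpos (by linarith [ht.2])] at h
  simpa using h

open Filter Topology in
-- Writing `Γ(ε) = Γ(ε + 1) / ε` turns the expression into `Γ(ε + 1)` times a difference quotient at
-- `0` of `Γ(b) / Γ(b + ε) - Γ(1) / Γ(1 + ε)`, whose derivative there is `ψ(1) - ψ(b)`.
theorem tendsto_Gamma_mul_sub {b : ℂ} (hb : 0 < b.re) :
    Tendsto (fun ε : ℝ => Gamma b * Gamma ε / Gamma (b + ε) - Gamma 1 * Gamma ε / Gamma (1 + ε))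
      (𝓝[>] 0) (𝓝 (digamma 1 - digamma b)) := by
  have hΓ : ∀ {c : ℂ}, 0 < c.re → HasDerivAt (fun ε : ℂ => Gamma c / Gamma (c + ε))
      (-digamma c) 0 := fun {c} hc => by
    have hd := (differentiableAt_Gamma c (ne_neg_natCast_of_re_pos hc)).hasDerivAt
    have hd' : HasDerivAt Gamma (deriv Gamma c) (c + 0) := by rwa [add_zero]
    have h1 : HasDerivAt (fun ε : ℂ => Gamma (c + ε)) (deriv Gamma c) 0 :=
      hd'.comp_const_add c 0
    have hne := Gamma_ne_zero_of_re_pos hc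
    have h2 := (hasDerivAt_const (0 : ℂ) (Gamma c)).div h1 (by simpa using hne)
    refine h2.congr_deriv ?_
    rw [digamma, logDeriv_apply, add_zero]
    field_simp
    ring
  have h1 := (hΓ hb).sub (hΓ (show 0 < (1 : ℂ).re by simp))
  rw [hasDerivAt_iff_tendsto_slope] at h1
  have hlim : Tendsto (fun ε : ℝ => (ε : ℂ)) (𝓝[>] 0) (𝓝[≠] 0) := by
    refine tendsto_nhdsWithin_iff.2 ⟨?_, ?_⟩
    · have : Tendsto (fun ε : ℝ => (ε : ℂ)) (𝓝 0) (𝓝 ((0 : ℝ) : ℂ)) :=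
        continuous_ofReal.tendsto 0
      rw [ofReal_zero] at this
      exact this.mono_left nhdsWithin_le_nhds
    · filter_upwards [self_mem_nhdsWithin] with ε hε
      simpa using (Set.mem_Ioi.1 hε).ne'
  have h2 := h1.comp hlim
  have h3 : Tendsto (fun ε : ℝ => Gamma (ε + 1)) (𝓝[>] 0) (𝓝 1) := by
    have hc : ContinuousAt Gamma (0 + 1) := by
      rw [zero_add]
      exact (differentiableAt_Gamma 1 (ne_neg_natCast_of_re_pos (by simp))).continuousAt
    have h4 : ContinuousAt (fun z : ℂ => Gamma (z + 1)) 0 :=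
      ContinuousAt.comp (g := Gamma) hc (by fun_prop)
    have h5 := (h4.tendsto.mono_left nhdsWithin_le_nhds).comp hlim
    simpa [Function.comp_def] using h5
  have h6 := h3.mul h2
  rw [one_mul, show -digamma b - -digamma 1 = digamma 1 - digamma b by ring] at h6
  refine h6.congr' ?_
  filter_upwards [self_mem_nhdsWithin] with ε hε
  have hε0 : (ε : ℂ) ≠ 0 := by exact_mod_cast (Set.mem_Ioi.1 hε).ne'
  have hb1 := Gamma_ne_zero_of_re_pos hb
  simp only [Function.comp_apply, slope, vsub_eq_sub, smul_eq_mul, Pi.sub_apply, add_zero,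
    sub_zero]
  rw [div_self hb1, div_self (by simp), sub_self, sub_zero, Gamma_add_one _ hε0]
  field_simp

open Filter Topology in
theorem integral_cpow_sub_one_div {b : ℂ} (hb : 2 ≤ b.re) :
    ∫ t in (0 : ℝ)..1, ((t : ℂ) ^ (b - 1) - 1) / (1 - t) = digamma 1 - digamma b := by
  have hb0 : 0 < b.re := by linarith
  have hIoc : Set.uIoc (0 : ℝ) 1 = Set.Ioc 0 1 := Set.uIoc_of_le zero_le_one
  refine tendsto_nhds_unique ?_ (tendsto_Gamma_mul_sub hb0)
  -- Regularise `1 / (1 - t)` to `(1 - t) ^ (ε - 1)`: for `ε > 0` the integral splits into the beta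
  -- values `B(b, ε) - B(1, ε)`, each of which diverges as `ε → 0`.
  have key : Tendsto (fun ε : ℝ => ∫ t in (0 : ℝ)..1,
      ((t : ℂ) ^ (b - 1) - 1) * (1 - (t : ℂ)) ^ ((ε : ℂ) - 1)) (𝓝[>] 0)
      (𝓝 (∫ t in (0 : ℝ)..1, ((t : ℂ) ^ (b - 1) - 1) / (1 - t))) := by
    refine intervalIntegral.tendsto_integral_filter_of_dominated_convergence
      (fun _ => ‖b - 1‖) ?_ ?_ (by simp) ?_
    · filter_upwards with ε
      exact Measurable.aestronglyMeasurable (by fun_prop)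
    · filter_upwards [self_mem_nhdsWithin] with ε hε
      rw [Set.mem_Ioi] at hε
      refine Filter.Eventually.of_forall fun t ht => ?_
      rw [hIoc] at ht
      rcases ht.2.eq_or_lt with rfl | ht1
      · simp
      have h1t : 0 < 1 - t := by linarith
      have h1 := norm_cpow_sub_one_le (s := b - 1) (by rw [sub_re, one_re]; linarith)
        (Set.Ioc_subset_Icc_self ht)
      have h2 : ‖(1 - (t : ℂ)) ^ ((ε : ℂ) - 1)‖ = (1 - t) ^ (ε - 1) := by
        have := norm_cpow_eq_rpow_re_of_pos h1t ((ε : ℂ) - 1)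
        simpa using this
      rw [norm_mul, h2]
      calc ‖(t : ℂ) ^ (b - 1) - 1‖ * (1 - t) ^ (ε - 1)
          ≤ ‖b - 1‖ * (1 - t) * (1 - t) ^ (ε - 1) := by gcongr
        _ = ‖b - 1‖ * (1 - t) ^ ε := by
          rw [Real.rpow_sub_one h1t.ne']
          field_simp
        _ ≤ ‖b - 1‖ := mul_le_of_le_one_right (norm_nonneg _)
          (Real.rpow_le_one h1t.le (by linarith [ht.1]) hε.le)
    · have hne : ∀ᵐ t : ℝ, t ≠ 1 := by
        simp [MeasureTheory.ae_iff]
      filter_upwards [hne] with t ht1 ht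
      rw [hIoc] at ht
      have h1t : (1 - (t : ℂ)) ≠ 0 := sub_ne_zero.2 (by exact_mod_cast ht1.symm)
      rw [div_eq_mul_inv, ← cpow_neg_one]
      refine Tendsto.const_mul _ ?_
      have hc : ContinuousAt (fun ε : ℝ => (1 - (t : ℂ)) ^ ((ε : ℂ) - 1)) 0 :=
        ContinuousAt.const_cpow (by fun_prop) (Or.inl h1t)
      have := hc.tendsto.mono_left (nhdsWithin_le_nhds (s := Set.Ioi 0))
      simpa using this
  refine key.congr' ?_
  filter_upwards [self_mem_nhdsWithin] with ε hε
  have hε0 : 0 < (ε : ℂ).re := by simpa using hε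
  rw [← betaIntegral_eq_Gamma_mul_div _ _ hb0 hε0,
    ← betaIntegral_eq_Gamma_mul_div _ _ (by simp) hε0, betaIntegral, betaIntegral,
    ← intervalIntegral.integral_sub (betaIntegral_convergent hb0 hε0)
      (betaIntegral_convergent (by simp) hε0)]
  refine intervalIntegral.integral_congr fun t _ => ?_
  simp only [sub_self, cpow_zero]
  ring

theorem intervalIntegrable_eulerInt {a b : ℂ} (ha : 0 < a.re) (hb : 0 < b.re) {w : ℂ}
    (hw : w ∈ cutPlane) : IntervalIntegrable (fun t : ℝ =>
      (t : ℂ) ^ (b - 1) * (1 - (t : ℂ)) ^ (a - 1) * (1 - w * t) ^ (-a))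
      MeasureTheory.volume 0 1 := by
  refine (betaIntegral_convergent hb ha).mul_continuousOn ?_
  rw [Set.uIcc_of_le zero_le_one]
  exact continuousOn_one_sub_mul_cpow_right hw _

open Filter Topology in
theorem tendsto_eulerInt_sub {a b : ℂ} (ha : 0 < a.re) (hb : 2 ≤ b.re) :
    Tendsto (fun x : ℝ => eulerInt a b (1 - x) - eulerInt a 1 (1 - x)) (𝓝[>] 0)
      (𝓝 (digamma 1 - digamma b)) := by
  have hb0 : 0 < b.re := by linarith
  have hIoc : Set.uIoc (0 : ℝ) 1 = Set.Ioc 0 1 := Set.uIoc_of_le zero_le_one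
  rw [← integral_cpow_sub_one_div hb]
  have hmem : ∀ᶠ x in 𝓝[>] (0 : ℝ), x ∈ Set.Ioo (0 : ℝ) 1 := Ioo_mem_nhdsGT one_pos
  have key : Tendsto (fun x : ℝ => ∫ t in (0 : ℝ)..1, ((t : ℂ) ^ (b - 1) - 1) *
      ((1 - (t : ℂ)) ^ (a - 1) * (1 - (1 - (x : ℂ)) * t) ^ (-a))) (𝓝[>] 0)
      (𝓝 (∫ t in (0 : ℝ)..1, ((t : ℂ) ^ (b - 1) - 1) / (1 - t))) := by
    refine intervalIntegral.tendsto_integral_filter_of_dominated_convergence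
      (fun _ => ‖b - 1‖) ?_ ?_ (by simp) ?_
    · filter_upwards with ε
      exact Measurable.aestronglyMeasurable (by fun_prop)
    · filter_upwards [hmem] with x hx
      have hne : ∀ᵐ t : ℝ, t ≠ 1 := by simp [MeasureTheory.ae_iff]
      filter_upwards [hne] with t ht1 ht
      rw [hIoc] at ht
      have h1t : 0 < 1 - t := sub_pos.2 (lt_of_le_of_ne ht.2 ht1)
      have h1 := norm_cpow_sub_one_le (s := b - 1) (by rw [sub_re, one_re]; linarith)
        (Set.Ioc_subset_Icc_self ht)
      have hxt : 1 - t ≤ 1 - (1 - x) * t := by nlinarith [hx.1, ht.1]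
      have hxt0 : 0 < 1 - (1 - x) * t := h1t.trans_le hxt
      have h2 : ‖(1 - (t : ℂ)) ^ (a - 1)‖ = (1 - t) ^ (a.re - 1) := by
        have := norm_cpow_eq_rpow_re_of_pos h1t (a - 1)
        simpa using this
      have h3 : ‖(1 - (1 - (x : ℂ)) * t) ^ (-a)‖ = (1 - (1 - x) * t) ^ (-a.re) := by
        have := norm_cpow_eq_rpow_re_of_pos hxt0 (-a)
        simpa using this
      rw [norm_mul, norm_mul, h2, h3]
      -- Since `1 - t ≤ 1 - (1 - x) t` and the exponent `-Re a` is negative, replacing the larger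
      -- base by `1 - t` gives a bound free of `x`; the powers of `1 - t` then cancel exactly.
      calc ‖(t : ℂ) ^ (b - 1) - 1‖ * ((1 - t) ^ (a.re - 1) * (1 - (1 - x) * t) ^ (-a.re))
          ≤ ‖b - 1‖ * (1 - t) * ((1 - t) ^ (a.re - 1) * (1 - t) ^ (-a.re)) := by
            gcongr ?_ * (_ * ?_)
            exact Real.rpow_le_rpow_of_nonpos h1t hxt (by linarith)
        _ = ‖b - 1‖ := by
          rw [← Real.rpow_add h1t, show a.re - 1 + -a.re = -1 by ring, Real.rpow_neg_one]
          field_simp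
    · have hne : ∀ᵐ t : ℝ, t ≠ 1 := by simp [MeasureTheory.ae_iff]
      filter_upwards [hne] with t ht1 ht
      rw [hIoc] at ht
      have h1t : 0 < 1 - t := sub_pos.2 (lt_of_le_of_ne ht.2 ht1)
      have h1t' : (1 - (t : ℂ)) ≠ 0 := by exact_mod_cast h1t.ne'
      have e : ((t : ℂ) ^ (b - 1) - 1) / (1 - t)
          = ((t : ℂ) ^ (b - 1) - 1) * ((1 - (t : ℂ)) ^ (a - 1) * (1 - (1 - ((0 : ℝ) : ℂ)) * t) ^ (-a)) := by
        rw [ofReal_zero, sub_zero, one_mul, ← cpow_add _ _ h1t', show a - 1 + -a = -1 by ring,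
          cpow_neg_one, div_eq_mul_inv]
      rw [e]
      refine Tendsto.const_mul _ (Tendsto.const_mul _ ?_)
      have hc : ContinuousAt (fun x : ℝ => (1 - (1 - (x : ℂ)) * t) ^ (-a)) 0 := by
        refine ContinuousAt.cpow (by fun_prop) continuousAt_const (Or.inl ?_)
        simpa using h1t
      exact hc.tendsto.mono_left nhdsWithin_le_nhds
  refine key.congr' ?_
  filter_upwards [hmem] with x hx
  have hw : (1 - (x : ℂ)) ∈ cutPlane := by
    left
    simpa using hx.1
  rw [eulerInt, eulerInt, ← intervalIntegral.integral_sub (intervalIntegrable_eulerInt ha hb0 hw)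
    (intervalIntegrable_eulerInt ha (by simp) hw)]
  refine intervalIntegral.integral_congr fun t _ => ?_
  simp only [sub_self, cpow_zero]
  ring

/-- The symmetry in the two parameters is invisible in the integral but evident in its Taylor
coefficients. It lets the reduction to parameter `1` be applied to `a` after `b`. -/
theorem eulerInt_one_right {a w : ℂ} (ha : 0 < a.re) (hw : ‖w‖ < 1) :
    eulerInt a 1 w = eulerInt 1 a w := by
  have h1 := hasSum_eulerInt ha (show 0 < (1 : ℂ).re by simp) hw
  rw [gaussCoeff_symm, add_comm] at h1
  exact h1.unique (hasSum_eulerInt (by simp) ha hw)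

/-- The reference case `₂F₁(1, 1; 2; w) = -log (1 - w) / w`, from which the logarithm enters. -/
theorem mul_eulerInt_one_one {w : ℂ} (hw : ‖w‖ < 1) : w * eulerInt 1 1 w = -log (1 - w) := by
  have h1 := (hasSum_eulerInt (show 0 < (1 : ℂ).re by simp) (show 0 < (1 : ℂ).re by simp)
    hw).mul_left w
  have h2 := (hasSum_nat_add_iff' 1).2 (hasSum_taylorSeries_neg_log hw)
  simp only [Finset.range_one, Finset.sum_singleton, pow_zero, Nat.cast_zero, div_zero,
    sub_zero] at h2
  refine h1.unique ?_
  have e : (fun k => w * (gaussCoeff 1 1 (1 + 1) k * w ^ k)) = fun k : ℕ =>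
      w ^ (k + 1) / ((k + 1 : ℕ) : ℂ) := by
    funext k
    have h3 := poch_succ_left 1 k
    rw [poch_one, one_mul, Nat.factorial_succ] at h3
    have h4 : (k.factorial : ℂ) ≠ 0 := by exact_mod_cast k.factorial_ne_zero
    have h5 : ((k : ℂ) + 1) ≠ 0 := by exact_mod_cast k.succ_ne_zero
    have h6 : Gamma (1 + 1) = 1 := by rw [Gamma_add_one 1 one_ne_zero, Gamma_one, one_mul]
    rw [gaussCoeff, ← h3, poch_one, h6, Gamma_one]
    push_cast
    field_simp
    ring
  rw [e]
  exact h2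

open Filter Topology in
theorem tendsto_eulerInt_add_log {a b : ℂ} (ha : 2 ≤ a.re) (hb : 2 ≤ b.re) :
    Tendsto (fun x : ℝ => eulerInt a b (1 - x) + log x) (𝓝[>] 0)
      (𝓝 (2 * digamma 1 - digamma a - digamma b)) := by
  -- Telescoping from `(a, b)` through `(a, 1)`, which equals `(1, a)`, to `(1, 1)`: the two
  -- differences have digamma limits, and the last integral carries the whole logarithm.
  have h1 := tendsto_eulerInt_sub (a := a) (by linarith) hb
  have h2 := tendsto_eulerInt_sub (a := 1) (by simp) ha
  have h3 : Tendsto (fun x : ℝ => eulerInt 1 1 (1 - x) + log x) (𝓝[>] 0) (𝓝 0) := by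
    have h4 : Tendsto (fun x : ℝ => ((Real.log x * x : ℝ) : ℂ) * (-1 / (1 - (x : ℂ)))) (𝓝[>] 0)
        (𝓝 (((0 : ℝ) : ℂ) * (-1 / (1 - ((0 : ℝ) : ℂ))))) := by
      refine Tendsto.mul ((continuous_ofReal.tendsto 0).comp ?_) ?_
      · simpa using tendsto_log_mul_rpow_nhdsGT_zero one_pos
      · have hc : ContinuousAt (fun x : ℝ => (-1 / (1 - (x : ℂ)))) 0 :=
          ContinuousAt.div (by fun_prop) (by fun_prop) (by simp)
        exact hc.tendsto.mono_left nhdsWithin_le_nhds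
    rw [ofReal_zero, zero_mul] at h4
    refine h4.congr' ?_
    filter_upwards [Ioo_mem_nhdsGT (one_pos (α := ℝ))] with x hx
    have hw : ‖(1 : ℂ) - x‖ < 1 := by
      rw [← ofReal_one, ← ofReal_sub, Complex.norm_of_nonneg (by linarith [hx.2])]
      linarith [hx.1]
    have h5 := mul_eulerInt_one_one hw
    have h6 : (1 : ℂ) - x ≠ 0 := by
      rw [← ofReal_one, ← ofReal_sub]
      exact_mod_cast (sub_pos.2 hx.2).ne'
    have h7 : eulerInt 1 1 (1 - x) = -log x / (1 - x) := by
      rw [eq_div_iff h6, mul_comm, h5, sub_sub_cancel]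
    rw [h7, ofReal_mul, ofReal_log hx.1.le]
    field_simp
    ring
  have h := (h1.add h2).add h3
  rw [show digamma 1 - digamma b + (digamma 1 - digamma a) + 0
    = 2 * digamma 1 - digamma a - digamma b by ring] at h
  refine h.congr' ?_
  filter_upwards [Ioo_mem_nhdsGT (one_pos (α := ℝ))] with x hx
  have hw : ‖(1 : ℂ) - x‖ < 1 := by
    rw [← ofReal_one, ← ofReal_sub, Complex.norm_of_nonneg (by linarith [hx.2])]
    linarith [hx.1]
  rw [eulerInt_one_right (a := a) (by linarith) hw]
  ring

/-! ### Logarithmic expansion in the zero-balanced case -/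

/-- The combination of digamma values in the logarithmic expansion. -/
noncomputable def digammaSum (μ ν : ℂ) (n k : ℕ) : ℂ :=
  digamma (k + 1) + digamma (k + n + 1) - digamma (k + μ) - digamma (k + ν)

theorem digammaSum_succ {μ ν : ℂ} (hμ : ∀ m : ℕ, μ ≠ -m) (hν : ∀ m : ℕ, ν ≠ -m) (n k : ℕ) :
    digammaSum μ ν n (k + 1) = digammaSum μ ν n k + 1 / (k + 1) + 1 / (k + n + 1)
      - 1 / (k + μ) - 1 / (k + ν) := by
  have h1 := digamma_apply_add_one (k + 1 : ℂ) (ne_neg_natCast_of_re_pos (by simp; positivity))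
  have h2 := digamma_apply_add_one (k + n + 1 : ℂ)
    (ne_neg_natCast_of_re_pos (by simp; positivity))
  have h3 := digamma_apply_add_one (μ + k) (ne_neg_natCast_add hμ k)
  have h4 := digamma_apply_add_one (ν + k) (ne_neg_natCast_add hν k)
  simp only [digammaSum]
  push_cast
  rw [h1, show (k : ℂ) + 1 + n + 1 = k + n + 1 + 1 by ring, h2,
    show (k : ℂ) + 1 + μ = μ + k + 1 by ring, h3, show (k : ℂ) + 1 + ν = ν + k + 1 by ring, h4,
    add_comm μ, add_comm ν]
  ring

theorem exists_norm_one_div_natCast_add_le (c : ℂ) :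
    ∃ B : ℝ, ∀ k : ℕ, ‖1 / ((k : ℂ) + c)‖ ≤ B := by
  obtain ⟨B, hB⟩ :=
    (Metric.isBounded_range_of_tendsto _ (tendsto_add_natCast_div 1 c)).exists_norm_le
  refine ⟨B, fun k => le_trans ?_ (hB _ ⟨k, rfl⟩)⟩
  have h1 : ‖(1 : ℂ) + k‖ = 1 + k := by exact_mod_cast Complex.norm_natCast (1 + k)
  rw [norm_div, norm_div, norm_one, h1, add_comm (k : ℂ)]
  gcongr
  linarith [k.cast_nonneg (α := ℝ)]

/-- Consecutive values differ by four bounded terms. Linear growth is cruder than the truth but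
suffices for convergence on the disc. -/
theorem exists_norm_digammaSum_le {μ ν : ℂ} (hμ : ∀ m : ℕ, μ ≠ -m) (hν : ∀ m : ℕ, ν ≠ -m)
    (n : ℕ) : ∃ C : ℝ, ∀ k : ℕ, ‖digammaSum μ ν n k‖ ≤ C * ((k : ℝ) + 1) := by
  obtain ⟨B₁, h₁⟩ := exists_norm_one_div_natCast_add_le 1
  obtain ⟨B₂, h₂⟩ := exists_norm_one_div_natCast_add_le (n + 1)
  obtain ⟨B₃, h₃⟩ := exists_norm_one_div_natCast_add_le μ
  obtain ⟨B₄, h₄⟩ := exists_norm_one_div_natCast_add_le ν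
  simp only [← add_assoc] at h₂
  have hB : 0 ≤ B₁ + B₂ + B₃ + B₄ := by
    linarith [(norm_nonneg _).trans (h₁ 0), (norm_nonneg _).trans (h₂ 0),
      (norm_nonneg _).trans (h₃ 0), (norm_nonneg _).trans (h₄ 0)]
  have h : ∀ k : ℕ, ‖digammaSum μ ν n k‖ ≤ ‖digammaSum μ ν n 0‖ + (B₁ + B₂ + B₃ + B₄) * k := by
    intro k
    induction k with
    | zero => simp
    | succ k ih =>
      rw [digammaSum_succ hμ hν]
      have f1 := norm_sub_le (digammaSum μ ν n k + 1 / (k + 1) + 1 / (k + n + 1)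
        - 1 / (k + μ)) (1 / (k + ν))
      have f2 := norm_sub_le (digammaSum μ ν n k + 1 / (k + 1) + 1 / (k + n + 1)) (1 / (k + μ))
      have f3 := norm_add_le (digammaSum μ ν n k + 1 / (k + 1)) (1 / (k + n + 1))
      have f4 := norm_add_le (digammaSum μ ν n k) (1 / (k + 1))
      push_cast
      linarith [h₁ k, h₂ k, h₃ k, h₄ k]
  refine ⟨‖digammaSum μ ν n 0‖ + (B₁ + B₂ + B₃ + B₄), fun k => (h k).trans ?_⟩
  nlinarith [norm_nonneg (digammaSum μ ν n 0), k.cast_nonneg (α := ℝ)]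

/-- Coefficients of the factor of `-log z` in the zero-balanced expansion. -/
noncomputable def balancedCoeff (a b : ℂ) (k : ℕ) : ℂ :=
  poch a k * poch b k / (k.factorial * k.factorial)

theorem convOnDisc_balancedCoeff (a b : ℂ) : ConvOnDisc (balancedCoeff a b) := by
  have := convOnDisc_poch_div a b 1 1
  simp only [poch_one] at this
  exact this

theorem balancedCoeff_succ (a b : ℂ) (k : ℕ) :
    (k + 1) * ((k + 1) * balancedCoeff a b (k + 1)) = (k + a) * (k + b) * balancedCoeff a b k := by
  have h4 : (k.factorial : ℂ) ≠ 0 := by exact_mod_cast k.factorial_ne_zero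
  have h5 : ((k : ℂ) + 1) ≠ 0 := by exact_mod_cast k.succ_ne_zero
  simp only [balancedCoeff, poch_succ, Nat.factorial_succ]
  push_cast
  field_simp
  ring

/-! ### Power-series solutions of the hypergeometric equation. -/

theorem psum_eq_of_hasSum {f v : ℕ → ℂ} {z s : ℂ} (hf : HasSum f s)
    (h : ∀ k, f k = v k * z ^ k) : psum v z = s := by
  rw [psum, ← hf.tsum_eq]
  exact tsum_congr fun k => (h k).symm

/-- The hypergeometric differential operator on power series. -/
theorem psum_hypergeometric_operator {u : ℕ → ℂ} (hu : ConvOnDisc u) (c e m : ℂ) {z : ℂ}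
    (hz : ‖z‖ < 1) :
    z * (1 - z) * psum (coeffDeriv (coeffDeriv u)) z + (c - e * z) * psum (coeffDeriv u) z
      - m * psum u z
      = psum (fun k => (k + c) * ((k + 1) * u (k + 1)) - (k * (k - 1) + e * k + m) * u k) z := by
  have hd := hu.coeffDeriv
  have h1 := (hd.natCast_mul).hasSum hz
  rw [psum_natCast_mul hd hz] at h1
  have h2 := (hd.natCast_mul).coeffShift.hasSum hz
  rw [psum_coeffShift hd.natCast_mul hz, psum_natCast_mul hd hz] at h2
  have h3 := hd.hasSum hz
  have h4 := hu.natCast_mul.hasSum hz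
  rw [psum_natCast_mul hu hz] at h4
  have h5 := hu.hasSum hz
  have h := (((h1.sub h2).add (h3.mul_left c)).sub (h4.mul_left e)).sub (h5.mul_left m)
  refine Eq.symm ((psum_eq_of_hasSum h fun k => ?_).trans (by ring))
  cases k with
  | zero =>
    simp only [coeffShift, coeffDeriv]
    push_cast
    ring
  | succ k =>
    simp only [coeffShift, coeffDeriv]
    push_cast
    ring

/-- Coefficients of the regular part of the zero-balanced expansion. -/
noncomputable def balancedRegCoeff (a b : ℂ) (k : ℕ) : ℂ :=
  balancedCoeff a b k * digammaSum a b 0 k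

theorem convOnDisc_balancedRegCoeff {a b : ℂ} (ha : ∀ m : ℕ, a ≠ -m) (hb : ∀ m : ℕ, b ≠ -m) :
    ConvOnDisc (balancedRegCoeff a b) :=
  (convOnDisc_balancedCoeff a b).mul_of_norm_le (exists_norm_digammaSum_le ha hb 0).choose_spec

theorem psum_zero_coeff (z : ℂ) : psum (fun _ => 0) z = 0 := by simp [psum]

theorem hypergeometric_eq_gaussCoeff {a b c : ℂ} (hc : ∀ m : ℕ, c ≠ -m) {z : ℂ} (hz : ‖z‖ < 1) :
    z * (1 - z) * psum (coeffDeriv (coeffDeriv (gaussCoeff a b c))) z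
      + (c - (a + b + 1) * z) * psum (coeffDeriv (gaussCoeff a b c)) z
      - a * b * psum (gaussCoeff a b c) z = 0 := by
  rw [psum_hypergeometric_operator (convOnDisc_gaussCoeff a b c) _ _ _ hz, ← psum_zero_coeff z]
  congr 1
  funext k
  have h4 : (k.factorial : ℂ) ≠ 0 := by exact_mod_cast k.factorial_ne_zero
  have h5 : ((k : ℂ) + 1) ≠ 0 := by exact_mod_cast k.succ_ne_zero
  have h6 := add_natCast_ne_zero hc k
  have h7 := poch_ne_zero hc k
  simp only [gaussCoeff, poch_succ, Nat.factorial_succ]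
  push_cast
  field_simp
  ring

theorem hypergeometric_eq_balancedCoeff (a b : ℂ) {z : ℂ} (hz : ‖z‖ < 1) :
    z * (1 - z) * psum (coeffDeriv (coeffDeriv (balancedCoeff a b))) z
      + (1 - (a + b + 1) * z) * psum (coeffDeriv (balancedCoeff a b)) z
      - a * b * psum (balancedCoeff a b) z = 0 := by
  rw [psum_hypergeometric_operator (convOnDisc_balancedCoeff a b) _ _ _ hz, ← psum_zero_coeff z]
  congr 1
  funext k
  linear_combination balancedCoeff_succ a b k

/-- The right side is what the operator produces from `log z` times the homogeneous solution `q =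
psum (balancedCoeff a b)`, apart from `log z` times the operator applied to `q`, which is `0`. Hence
`p - q log z` solves the homogeneous equation. -/
theorem hypergeometric_eq_balancedRegCoeff {a b : ℂ} (ha : ∀ m : ℕ, a ≠ -m)
    (hb : ∀ m : ℕ, b ≠ -m) {z : ℂ} (hz : ‖z‖ < 1) :
    z * (1 - z) * psum (coeffDeriv (coeffDeriv (balancedRegCoeff a b))) z
      + (1 - (a + b + 1) * z) * psum (coeffDeriv (balancedRegCoeff a b)) z
      - a * b * psum (balancedRegCoeff a b) z
      = 2 * (1 - z) * psum (coeffDeriv (balancedCoeff a b)) z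
        - (a + b) * psum (balancedCoeff a b) z := by
  have hq := convOnDisc_balancedCoeff a b
  rw [psum_hypergeometric_operator (convOnDisc_balancedRegCoeff ha hb) _ _ _ hz]
  have h1 := hq.natCast_mul.hasSum hz
  rw [psum_natCast_mul hq hz] at h1
  have h := (((hq.coeffDeriv.hasSum hz).sub h1).mul_left 2).sub ((hq.hasSum hz).mul_left (a + b))
  refine (psum_eq_of_hasSum h fun k => ?_).trans (by ring)
  have h5 : ((k : ℂ) + 1) ≠ 0 := by exact_mod_cast k.succ_ne_zero
  have h6 : (k : ℂ) + a ≠ 0 := by rw [add_comm]; exact add_natCast_ne_zero ha k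
  have h7 : (k : ℂ) + b ≠ 0 := by rw [add_comm]; exact add_natCast_ne_zero hb k
  have hs := balancedCoeff_succ a b k
  have hs' : balancedCoeff a b (k + 1)
      = (k + a) * (k + b) * balancedCoeff a b k / ((k + 1) * (k + 1)) := by
    rw [← hs]
    field_simp
  simp only [balancedRegCoeff, coeffDeriv, digammaSum_succ ha hb, hs']
  push_cast
  field_simp
  ring

open Filter Topology in
/-- The expansion of the zero-balanced Gauss function at its logarithmic singular point, for
parameters with large real part. -/
theorem eulerInt_one_sub_eq {a b : ℂ} (ha : 2 ≤ a.re) (hb : 2 ≤ b.re) {z : ℂ} (hz : ‖z‖ < 1)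
    (hzs : z ∈ slitPlane) :
    eulerInt a b (1 - z)
      = psum (balancedRegCoeff a b) z - log z * psum (balancedCoeff a b) z := by
  have ha0 : 0 < a.re := by linarith
  have hb0 : 0 < b.re := by linarith
  have hc : ∀ m : ℕ, a + b ≠ -m := ne_neg_natCast_of_re_pos (by rw [add_re]; linarith)
  have hu := convOnDisc_gaussCoeff a b (a + b)
  have hq := convOnDisc_balancedCoeff a b
  have ha' := ne_neg_natCast_of_re_pos ha0
  have hb' := ne_neg_natCast_of_re_pos hb0
  have hp := convOnDisc_balancedRegCoeff ha' hb'
  set u := gaussCoeff a b (a + b)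
  set p := balancedRegCoeff a b
  set q := balancedCoeff a b
  have hnorm : ∀ x ∈ Set.Ioo (0 : ℝ) 1, ‖(x : ℂ)‖ < 1 := fun x hx => by
    rw [Complex.norm_of_nonneg hx.1.le]
    exact hx.2
  have hnorm' : ∀ x ∈ Set.Ioo (0 : ℝ) 1, ‖1 - (x : ℂ)‖ < 1 := fun x hx => by
    rw [← ofReal_one, ← ofReal_sub, Complex.norm_of_nonneg (by linarith [hx.2])]
    linarith [hx.1]
  have hslit : ∀ x ∈ Set.Ioo (0 : ℝ) 1, (x : ℂ) ∈ slitPlane := fun x hx => by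
    left
    simpa using hx.1
  have hmem : ∀ᶠ x in 𝓝[>] (0 : ℝ), x ∈ Set.Ioo (0 : ℝ) 1 := Ioo_mem_nhdsGT one_pos
  have hsub : ∀ x : ℝ, HasDerivAt (fun w : ℂ => 1 - w) (-1) (x : ℂ) := fun x =>
    (hasDerivAt_id _).const_sub 1
  have hofReal : Tendsto (fun x : ℝ => (x : ℂ)) (𝓝[>] 0) (𝓝 0) := by
    have := (continuous_ofReal.tendsto 0).mono_left (nhdsWithin_le_nhds (s := Set.Ioi 0))
    rwa [ofReal_zero] at this
  have hpt : Tendsto (fun x : ℝ => psum p x) (𝓝[>] 0) (𝓝 (p 0)) := by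
    have h1 : ContinuousAt (psum p) 0 := hp.continuousAt (by simp)
    have h2 := h1.tendsto.comp hofReal
    rwa [psum_zero] at h2
  have hq0 : q 0 = 1 := by simp [q, balancedCoeff, poch_zero]
  have hqt : Tendsto (fun x : ℝ => psum q x) (𝓝[>] 0) (𝓝 1) := by
    have h1 : ContinuousAt (psum q) 0 := hq.continuousAt (by simp)
    have h2 := h1.tendsto.comp hofReal
    rwa [psum_zero, hq0] at h2
  -- For third parameter `a + b`, the substitution `w = 1 - x` turns the hypergeometric equation
  -- into the one with third parameter `1`, so the three pieces can be compared at `x = 0`.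
  have hD : ∀ᶠ x : ℝ in 𝓝[>] 0, psum u (1 - x) - psum p x + log x * psum q x = 0 := by
    refine eventually_eq_zero_of_hypergeometric_eq (s := a + b) (m := a * b)
      (y := fun x : ℝ => psum u (1 - x) - psum p x + log x * psum q x)
      (y' := fun x : ℝ => -psum (coeffDeriv u) (1 - x) - psum (coeffDeriv p) x
        + ((x : ℂ)⁻¹ * psum q x + log x * psum (coeffDeriv q) x))
      (y'' := fun x : ℝ => psum (coeffDeriv (coeffDeriv u)) (1 - x)
        - psum (coeffDeriv (coeffDeriv p)) x
        + ((-((x : ℂ) ^ 2)⁻¹ * psum q x + (x : ℂ)⁻¹ * psum (coeffDeriv q) x)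
        + ((x : ℂ)⁻¹ * psum (coeffDeriv q) x + log x * psum (coeffDeriv (coeffDeriv q)) x)))
      (g := fun x : ℝ => psum q x) (g' := fun x : ℝ => psum (coeffDeriv q) x)
      (g'' := fun x : ℝ => psum (coeffDeriv (coeffDeriv q)) x) ?_ ?_ ?_ ?_ ?_ ?_ ?_ hqt
    · intro x hx
      have h1 := (hu.hasDerivAt (hnorm' x hx)).comp (x : ℂ) (hsub x)
      have h2 := (h1.sub (hp.hasDerivAt (hnorm x hx))).add
        ((hasDerivAt_log (hslit x hx)).mul (hq.hasDerivAt (hnorm x hx)))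
      refine (h2.congr_deriv ?_).comp_ofReal
      ring
    · intro x hx
      have hx0 : (x : ℂ) ≠ 0 := slitPlane_ne_zero (hslit x hx)
      have h1 := ((hu.coeffDeriv.hasDerivAt (hnorm' x hx)).comp (x : ℂ) (hsub x)).neg
      have h2 := (h1.sub (hp.coeffDeriv.hasDerivAt (hnorm x hx))).add
        (((hasDerivAt_inv hx0).mul (hq.hasDerivAt (hnorm x hx))).add
        ((hasDerivAt_log (hslit x hx)).mul (hq.coeffDeriv.hasDerivAt (hnorm x hx))))
      refine (h2.congr_deriv ?_).comp_ofReal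
      ring
    · intro x hx
      have hx0 : (x : ℂ) ≠ 0 := slitPlane_ne_zero (hslit x hx)
      have h1 := hypergeometric_eq_gaussCoeff (a := a) (b := b) hc (hnorm' x hx)
      have h2 := hypergeometric_eq_balancedCoeff a b (hnorm x hx)
      have h3 := hypergeometric_eq_balancedRegCoeff ha' hb' (hnorm x hx)
      have e : (x : ℂ) * (1 - x) * (-((x : ℂ) ^ 2)⁻¹ * psum q x)
          + (1 - (a + b + 1) * x) * ((x : ℂ)⁻¹ * psum q x) = -(a + b) * psum q x := by
        field_simp
        ring
      have e' : (x : ℂ) * (1 - x) * ((x : ℂ)⁻¹ * psum (coeffDeriv q) x)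
          = (1 - x) * psum (coeffDeriv q) x := by
        field_simp
      linear_combination h1 - h3 + log x * h2 + e + 2 * e'
    · exact fun x hx => (hq.hasDerivAt (hnorm x hx)).comp_ofReal
    · exact fun x hx => (hq.coeffDeriv.hasDerivAt (hnorm x hx)).comp_ofReal
    · exact fun x hx => hypergeometric_eq_balancedCoeff a b (hnorm x hx)
    · have h1 := tendsto_eulerInt_add_log ha hb
      -- Since `q 0 = 1`, the slope of `psum q` at `0` stays bounded, and `x log x → 0` finishes.
      have h2 : Tendsto (fun x : ℝ => log x * (psum q x - 1)) (𝓝[>] 0) (𝓝 0) := by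
        have hs : Tendsto (fun x : ℝ => slope (psum q) 0 x) (𝓝[>] 0) (𝓝 (psum (coeffDeriv q) 0)) := by
          have h3 := hasDerivAt_iff_tendsto_slope.1 (hq.hasDerivAt (z := 0) (by simp))
          refine h3.comp (tendsto_nhdsWithin_iff.2 ⟨hofReal, ?_⟩)
          filter_upwards [self_mem_nhdsWithin] with x hx
          simpa using (Set.mem_Ioi.1 hx).ne'
        have hl : Tendsto (fun x : ℝ => ((Real.log x * x : ℝ) : ℂ)) (𝓝[>] 0) (𝓝 ((0 : ℝ) : ℂ)) := by
          refine (continuous_ofReal.tendsto 0).comp ?_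
          simpa using tendsto_log_mul_rpow_nhdsGT_zero one_pos
        have h4 := hl.mul hs
        rw [ofReal_zero, zero_mul] at h4
        refine h4.congr' ?_
        filter_upwards [hmem] with x hx
        have hx0 : (x : ℂ) ≠ 0 := slitPlane_ne_zero (hslit x hx)
        rw [slope, vsub_eq_sub, smul_eq_mul, psum_zero, hq0, ofReal_mul, ofReal_log hx.1.le,
          sub_zero]
        field_simp
      have h5 := (h1.sub hpt).add h2
      have hp0 : p 0 = 2 * digamma 1 - digamma a - digamma b := by
        simp only [p, balancedRegCoeff, digammaSum, q] at hq0 ⊢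
        rw [hq0]
        simp only [Nat.cast_zero, zero_add]
        ring
      rw [hp0, sub_self, zero_add] at h5
      refine h5.congr' ?_
      filter_upwards [hmem] with x hx
      rw [← (hasSum_eulerInt ha0 hb0 (hnorm' x hx)).tsum_eq]
      simp only [psum, u]
      ring
  obtain ⟨δ, hδ, hδ'⟩ := mem_nhdsGT_iff_exists_Ioo_subset.1 (hmem.and hD)
  have hδ0 : (0 : ℝ) < δ := hδ
  set U : Set ℂ := Metric.ball 0 1 ∩ slitPlane with hU
  have hUo : IsOpen U := Metric.isOpen_ball.inter isOpen_slitPlane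
  have hUc : IsPreconnected U := by
    have h1 : StarConvex ℝ ((1 / 2 : ℝ) : ℂ) U := by
      refine StarConvex.inter ?_ (starConvex_ofReal_slitPlane (by norm_num))
      refine (convex_ball (0 : ℂ) 1).starConvex ?_
      exact mem_ball_zero_iff.2 (hnorm _ (by constructor <;> norm_num))
    have hne : ((1 / 2 : ℝ) : ℂ) ∈ U := ⟨
      mem_ball_zero_iff.2 (hnorm _ (by constructor <;> norm_num)),
      hslit _ (by constructor <;> norm_num)⟩
    exact (h1.isPathConnected hne).isConnected.isPreconnected
  have hF : DifferentiableOn ℂ (fun z => eulerInt a b (1 - z)) U :=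
    (differentiableOn_eulerInt ha0 hb0).comp (by fun_prop) fun z hz => by
      change 1 - (1 - z) ∈ slitPlane
      rw [sub_sub_cancel]
      exact hz.2
  have hG : DifferentiableOn ℂ (fun z => psum p z - log z * psum q z) U := by
    refine (hp.differentiableOn.mono Set.inter_subset_left).sub
      (DifferentiableOn.mul ?_ (hq.differentiableOn.mono Set.inter_subset_left))
    exact differentiableOn_id.clog fun z hz => hz.2
  have hx1 : δ / 2 ∈ Set.Ioo 0 δ := ⟨by linarith, by linarith⟩
  have hz₀ : ((δ / 2 : ℝ) : ℂ) ∈ U :=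
    ⟨mem_ball_zero_iff.2 (hnorm _ (hδ' hx1).1), hslit _ (hδ' hx1).1⟩
  -- Equality is known only on a real interval, whose points accumulate at `δ / 2`; this is enough
  -- for the identity theorem on the slit disc, star-shaped about `1 / 2`.
  refine (hF.analyticOnNhd hUo).eqOn_of_preconnected_of_frequently_eq (hG.analyticOnNhd hUo) hUc
    hz₀ ?_ ⟨mem_ball_zero_iff.2 hz, hzs⟩
  have hev : ∀ᶠ x : ℝ in 𝓝[≠] (δ / 2), eulerInt a b (1 - x) = psum p x - log x * psum q x := by
    filter_upwards [nhdsWithin_le_nhds (Ioo_mem_nhds hx1.1 hx1.2)] with x hx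
    have h1 := (hδ' hx).2
    rw [psum, (hasSum_eulerInt ha0 hb0 (hnorm' x (hδ' hx).1)).tsum_eq] at h1
    linear_combination h1
  have ht : Tendsto (fun x : ℝ => (x : ℂ)) (𝓝[≠] (δ / 2)) (𝓝[≠] ((δ / 2 : ℝ) : ℂ)) := by
    refine tendsto_nhdsWithin_iff.2 ⟨(continuous_ofReal.tendsto _).mono_left nhdsWithin_le_nhds, ?_⟩
    filter_upwards [self_mem_nhdsWithin] with x hx
    exact fun h => hx (ofReal_injective h)
  exact ht.frequently hev.frequently

/-! ### The logarithmic expansion and contiguity -/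

/-- The product `(μ - n)_j (ν - n)_j / j!`. -/
noncomputable def pochQuot (μ ν : ℂ) (n j : ℕ) : ℂ :=
  poch (μ - n) j * poch (ν - n) j / j.factorial

/-- Coefficients of the factor of `-log z` in the expansion of the normalised Gauss function. -/
noncomputable def logCoeff (μ ν : ℂ) (n k : ℕ) : ℂ :=
  (-1) ^ n * pochQuot μ ν n (n + k) / k.factorial

/-- Coefficients of `z ^ n` times the part without logarithm in the expansion of the normalised
Gauss function. -/
noncomputable def regCoeff (μ ν : ℂ) (n j : ℕ) : ℂ :=
  if j < n then (-1) ^ j * (n - 1 - j).factorial * pochQuot μ ν n j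
  else logCoeff μ ν n (j - n) * digammaSum μ ν n (j - n)

/-- The normalised Gauss function `Γ(μ) Γ(ν) / Γ(μ + ν - n) ₂F₁(μ, ν; μ + ν - n; w)` continues to
the cut plane and has a logarithmic expansion at `w = 1`. -/
def HasLogExpansion (μ ν : ℂ) (n : ℕ) : Prop :=
  ConvOnDisc (regCoeff μ ν n) ∧ ConvOnDisc (logCoeff μ ν n) ∧
  ∃ f : ℂ → ℂ, DifferentiableOn ℂ f cutPlane ∧
    (∀ w : ℂ, ‖w‖ < 1 → f w = psum (gaussCoeff μ ν (μ + ν - n)) w) ∧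
    ∀ z : ℂ, ‖z‖ < 1 → z ∈ slitPlane →
      f (1 - z) = psum (regCoeff μ ν n) z / z ^ n - log z * psum (logCoeff μ ν n) z

theorem pochQuot_symm (μ ν : ℂ) (n : ℕ) : pochQuot μ ν n = pochQuot ν μ n := by
  funext j
  simp only [pochQuot]
  ring

theorem digammaSum_symm (μ ν : ℂ) (n : ℕ) : digammaSum μ ν n = digammaSum ν μ n := by
  funext j
  simp only [digammaSum]
  ring

theorem logCoeff_symm (μ ν : ℂ) (n : ℕ) : logCoeff μ ν n = logCoeff ν μ n := by
  funext j
  simp only [logCoeff, pochQuot_symm]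

theorem regCoeff_symm (μ ν : ℂ) (n : ℕ) : regCoeff μ ν n = regCoeff ν μ n := by
  funext j
  simp only [regCoeff, pochQuot_symm μ, logCoeff_symm μ, digammaSum_symm μ]

theorem HasLogExpansion.symm {μ ν : ℂ} {n : ℕ} (h : HasLogExpansion μ ν n) :
    HasLogExpansion ν μ n := by
  unfold HasLogExpansion at h ⊢
  rwa [regCoeff_symm ν, logCoeff_symm ν, gaussCoeff_symm ν, add_comm ν]

theorem logCoeff_zero_eq (a b : ℂ) : logCoeff a b 0 = balancedCoeff a b := by
  funext k
  simp [logCoeff, pochQuot, balancedCoeff, div_div]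

theorem regCoeff_zero_eq (a b : ℂ) : regCoeff a b 0 = balancedRegCoeff a b := by
  funext k
  simp [regCoeff, balancedRegCoeff, logCoeff_zero_eq]

theorem hasLogExpansion_zero_of_two_le_re {a b : ℂ} (ha : 2 ≤ a.re) (hb : 2 ≤ b.re) :
    HasLogExpansion a b 0 := by
  have ha0 : 0 < a.re := by linarith
  have hb0 : 0 < b.re := by linarith
  unfold HasLogExpansion
  rw [regCoeff_zero_eq, logCoeff_zero_eq]
  refine ⟨convOnDisc_balancedRegCoeff (ne_neg_natCast_of_re_pos ha0)
    (ne_neg_natCast_of_re_pos hb0), convOnDisc_balancedCoeff a b,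
    eulerInt a b, differentiableOn_eulerInt ha0 hb0, fun w hw => ?_, fun z hz hzs => ?_⟩
  · rw [Nat.cast_zero, sub_zero, psum, (hasSum_eulerInt ha0 hb0 hw).tsum_eq]
  · rw [pow_zero, div_one, eulerInt_one_sub_eq ha hb hz hzs]

theorem one_sub_mem_cutPlane {z : ℂ} (hz : z ∈ slitPlane) : 1 - z ∈ cutPlane := by
  change 1 - (1 - z) ∈ slitPlane
  rwa [sub_sub_cancel]

theorem hasDerivAt_comp_one_sub {f : ℂ → ℂ} (hf : DifferentiableOn ℂ f cutPlane) {z : ℂ}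
    (hz : z ∈ slitPlane) : HasDerivAt (fun z => f (1 - z)) (-deriv f (1 - z)) z := by
  have h1 : HasDerivAt f (deriv f (1 - z)) (1 - z) :=
    (hf.differentiableAt (isOpen_cutPlane.mem_nhds (one_sub_mem_cutPlane hz))).hasDerivAt
  have h2 : HasDerivAt (fun w : ℂ => 1 - w) (-1) z := (hasDerivAt_id _).const_sub 1
  exact (h1.comp z h2).congr_deriv (by ring)

theorem HasSum.psum_eq {u : ℕ → ℂ} {z s : ℂ} (h : HasSum (fun k => u k * z ^ k) s) :
    psum u z = s := h.tsum_eq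

theorem HasSum.of_coeff {f v : ℕ → ℂ} {z s s' : ℂ} (hf : HasSum f s)
    (h : ∀ k, f k = v k * z ^ k) (hs : s = s') : HasSum (fun k => v k * z ^ k) s' := by
  rw [← hs, ← funext h]
  exact hf

theorem deriv_eq_psum_coeffDeriv {f : ℂ → ℂ} {u : ℕ → ℂ} (hu : ConvOnDisc u)
    (hf : ∀ w : ℂ, ‖w‖ < 1 → f w = psum u w) {w : ℂ} (hw : ‖w‖ < 1) :
    deriv f w = psum (coeffDeriv u) w := by
  rw [← (hu.hasDerivAt hw).deriv]
  refine Filter.EventuallyEq.deriv_eq ?_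
  filter_upwards [Metric.isOpen_ball.mem_nhds (mem_ball_zero_iff.2 hw)] with x hx
  exact hf x (mem_ball_zero_iff.1 hx)

theorem deriv_eq_of_log_expansion {f : ℂ → ℂ} {h q : ℕ → ℂ} {n : ℕ} (hh : ConvOnDisc h)
    (hq : ConvOnDisc q) (hf : DifferentiableOn ℂ f cutPlane)
    (hexp : ∀ z : ℂ, ‖z‖ < 1 → z ∈ slitPlane →
      f (1 - z) = psum h z / z ^ n - log z * psum q z) {z : ℂ} (hz : ‖z‖ < 1)
    (hzs : z ∈ slitPlane) :
    deriv f (1 - z) = -(psum (coeffDeriv h) z / z ^ n - n * psum h z / z ^ (n + 1)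
      - (psum q z / z + log z * psum (coeffDeriv q) z)) := by
  have hz0 := slitPlane_ne_zero hzs
  have h1 := ((hh.hasDerivAt hz).div (hasDerivAt_pow n z) (pow_ne_zero n hz0)).sub
    ((hasDerivAt_log hzs).mul (hq.hasDerivAt hz))
  have h2 : (fun z => f (1 - z)) =ᶠ[nhds z] (psum h / fun z => z ^ n) - log * psum q := by
    filter_upwards [Metric.isOpen_ball.mem_nhds (mem_ball_zero_iff.2 hz),
      isOpen_slitPlane.mem_nhds hzs] with x hx hxs
    exact hexp x (mem_ball_zero_iff.1 hx) hxs
  have h3 := (hasDerivAt_comp_one_sub hf hzs).unique (h1.congr_of_eventuallyEq h2)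
  rw [← neg_eq_iff_eq_neg, h3]
  -- The truncated exponent `n - 1` is harmless at `n = 0` because the factor `n` vanishes.
  have e : (n : ℂ) * z ^ (n - 1) * z = n * z ^ n := by
    cases n with
    | zero => simp
    | succ n => rw [Nat.add_sub_cancel, pow_succ]; ring
  have e' : (n : ℂ) * z ^ (n - 1) = n * z ^ n / z := by
    rw [← e]
    field_simp
  rw [e', pow_succ]
  field_simp
  ring

/-! ### Contiguity in a numerator parameter, zero-balanced case. -/

theorem gaussCoeff_lower_zero {a b : ℂ} (ha0 : a ≠ 0) (hab0 : a + b ≠ 0) :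
    a * gaussCoeff a b (a + b) 0 = (a + b) * gaussCoeff (a + 1) b (a + 1 + b) 0 := by
  simp only [gaussCoeff, poch_zero, show a + 1 + b = a + b + 1 by ring, Gamma_add_one a ha0,
    Gamma_add_one _ hab0]
  field_simp

theorem gaussCoeff_lower {a b : ℂ} (ha0 : a ≠ 0) (hab : ∀ m : ℕ, a + b ≠ -m) (k : ℕ) :
    a * gaussCoeff a b (a + b) (k + 1)
      = (k + 1 + a + b) * gaussCoeff (a + 1) b (a + 1 + b) (k + 1)
        - (k + b) * gaussCoeff (a + 1) b (a + 1 + b) k := by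
  have hab0 : a + b ≠ 0 := by simpa using hab 0
  have hab1 := ne_neg_natCast_add hab 1
  rw [Nat.cast_one] at hab1
  have h1 := poch_ne_zero hab1 k
  have h2 := add_natCast_ne_zero hab1 k
  have h3 := Gamma_ne_zero hab
  have h4 : (k.factorial : ℂ) ≠ 0 := by exact_mod_cast k.factorial_ne_zero
  have h5 : ((k : ℂ) + 1) ≠ 0 := by exact_mod_cast k.succ_ne_zero
  simp only [gaussCoeff, show a + 1 + b = a + b + 1 by ring, Gamma_add_one a ha0,
    Gamma_add_one _ hab0, poch_succ_left a, poch_succ_left (a + b), poch_succ (a + 1),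
    poch_succ (a + b + 1), poch_succ b, Nat.factorial_succ]
  push_cast
  field_simp
  ring

/-- Lowering the first parameter in the zero-balanced case. -/
theorem HasLogExpansion.lower {a b : ℂ} (h : HasLogExpansion (a + 1) b 0)
    (ha : ∀ m : ℕ, a ≠ -m) (hb : ∀ m : ℕ, b ≠ -m) (hab : ∀ m : ℕ, a + b ≠ -m) :
    HasLogExpansion a b 0 := by
  unfold HasLogExpansion at h ⊢
  rw [regCoeff_zero_eq, logCoeff_zero_eq] at h ⊢
  obtain ⟨hp, hq, f, hf, hball, hexp⟩ := h
  have hderiv := fun {z : ℂ} (hz : ‖z‖ < 1) (hzs : z ∈ slitPlane) =>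
    deriv_eq_of_log_expansion hp hq hf hexp hz hzs
  simp only [Nat.cast_zero, sub_zero, pow_zero, div_one, zero_mul, zero_div] at hball hexp hderiv ⊢
  have hu := convOnDisc_gaussCoeff (a + 1) b (a + 1 + b)
  have ha0 : a ≠ 0 := by simpa using ha 0
  have hstep : ∀ k : ℕ, a * balancedCoeff a b (k + 1)
      = (a - (k + 1)) * balancedCoeff (a + 1) b (k + 1)
        + (b + k) * balancedCoeff (a + 1) b k := by
    intro k
    have h4 : (k.factorial : ℂ) ≠ 0 := by exact_mod_cast k.factorial_ne_zero
    have h5 : ((k : ℂ) + 1) ≠ 0 := by exact_mod_cast k.succ_ne_zero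
    simp only [balancedCoeff, poch_succ (a + 1), poch_succ b, poch_succ_left a,
      Nat.factorial_succ]
    push_cast
    field_simp
    ring
  have hratio : ∀ k : ℕ, (k + a) * balancedCoeff a b k = a * balancedCoeff (a + 1) b k := by
    intro k
    simp only [balancedCoeff]
    linear_combination (poch b k / (k.factorial * k.factorial))
      * ((poch_succ a k).symm.trans (poch_succ_left a k))
  have hstep0 : balancedCoeff a b 0 = balancedCoeff (a + 1) b 0 := by
    simp [balancedCoeff, poch_zero]
  have hlog : ∀ {z : ℂ}, ‖z‖ < 1 → HasSum (fun k => balancedCoeff a b k * z ^ k)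
      (a⁻¹ * (-(1 - z) * (z * psum (coeffDeriv (balancedCoeff (a + 1) b)) z)
        + (a + b * z) * psum (balancedCoeff (a + 1) b) z)) := by
    intro z hz
    have h1 := hq.natCast_mul.hasSum hz
    have h2 := hq.natCast_mul.coeffShift.hasSum hz
    rw [psum_coeffShift hq.natCast_mul hz] at h2
    rw [psum_natCast_mul hq hz] at h1 h2
    have h4 := hq.coeffShift.hasSum hz
    rw [psum_coeffShift hq hz] at h4
    refine HasSum.of_coeff (((h2.sub h1).add
      (((hq.hasSum hz).mul_left a).add (h4.mul_left b))).mul_left a⁻¹) (fun k => ?_) (by ring)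
    rw [inv_mul_eq_iff_eq_mul₀ ha0]
    cases k with
    | zero =>
      simp only [coeffShift, hstep0, Nat.cast_zero]
      ring
    | succ k =>
      simp only [coeffShift]
      have := hstep k
      push_cast
      linear_combination -z ^ (k + 1) * this
  -- In `z = 1 - w` the operator `w (1 - w) d/dw + a + b - b w` reads `-z (1 - z) d/dz + a + b z`.
  -- The extra term `(1 - z) q` comes from differentiating the logarithm.
  have hreg : ∀ {z : ℂ}, ‖z‖ < 1 → HasSum (fun k => balancedRegCoeff a b k * z ^ k)
      (a⁻¹ * (-(1 - z) * (z * psum (coeffDeriv (balancedRegCoeff (a + 1) b)) z)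
        + (a + b * z) * psum (balancedRegCoeff (a + 1) b) z
        + (1 - z) * psum (balancedCoeff (a + 1) b) z)) := by
    intro z hz
    have h1 := hp.natCast_mul.hasSum hz
    have h2 := hp.natCast_mul.coeffShift.hasSum hz
    rw [psum_coeffShift hp.natCast_mul hz] at h2
    rw [psum_natCast_mul hp hz] at h1 h2
    have h4 := hp.coeffShift.hasSum hz
    rw [psum_coeffShift hp hz] at h4
    have h6 := hq.coeffShift.hasSum hz
    rw [psum_coeffShift hq hz] at h6
    refine HasSum.of_coeff (((h2.sub h1).add (((hp.hasSum hz).mul_left a).add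
      (h4.mul_left b))).add ((hq.hasSum hz).sub h6) |>.mul_left a⁻¹) (fun k => ?_) (by ring)
    rw [inv_mul_eq_iff_eq_mul₀ ha0]
    have hdig : ∀ k : ℕ, digammaSum (a + 1) b 0 k = digammaSum a b 0 k - 1 / (a + k) := by
      intro k
      have h3 := digamma_apply_add_one (a + k) (ne_neg_natCast_add ha k)
      rw [add_comm a] at h3
      simp only [digammaSum, ← add_assoc, h3]
      ring
    cases k with
    | zero =>
      simp only [coeffShift, balancedRegCoeff, hstep0, hdig, Nat.cast_zero, add_zero]
      field_simp
      ring
    | succ k =>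
      have h4 : (k.factorial : ℂ) ≠ 0 := by exact_mod_cast k.factorial_ne_zero
      have h5 : ((k : ℂ) + 1) ≠ 0 := by exact_mod_cast k.succ_ne_zero
      have h7 : (k : ℂ) + a ≠ 0 := by rw [add_comm]; exact add_natCast_ne_zero ha k
      have h8 : (k : ℂ) + b ≠ 0 := by rw [add_comm]; exact add_natCast_ne_zero hb k
      have h9 : (k : ℂ) + 1 + a ≠ 0 := by
        have := add_natCast_ne_zero ha (k + 1)
        push_cast at this
        rwa [add_comm]
      have e1 : balancedCoeff a b (k + 1)
          = (k + a) * (k + b) * balancedCoeff a b k / ((k + 1) * (k + 1)) := by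
        rw [← balancedCoeff_succ]
        field_simp
      have e2 : balancedCoeff (a + 1) b k = (k + a) / a * balancedCoeff a b k := by
        rw [div_mul_eq_mul_div, hratio, mul_div_cancel_left₀ _ ha0]
      have e3 : balancedCoeff (a + 1) b (k + 1)
          = (k + 1 + a) / a * balancedCoeff a b (k + 1) := by
        have := hratio (k + 1)
        push_cast at this
        rw [div_mul_eq_mul_div, this, mul_div_cancel_left₀ _ ha0]
      simp only [coeffShift, balancedRegCoeff, hdig, e3, e2, e1, digammaSum_succ ha hb]
      rw [add_comm a, add_comm a]
      push_cast
      field_simp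
      ring
  have hgauss : ∀ {w : ℂ}, ‖w‖ < 1 → HasSum (fun k => gaussCoeff a b (a + b) k * w ^ k)
      (a⁻¹ * (w * (1 - w) * psum (coeffDeriv (gaussCoeff (a + 1) b (a + 1 + b))) w
        + (a + b - b * w) * psum (gaussCoeff (a + 1) b (a + 1 + b)) w)) := by
    intro w hw
    have h1 := hu.natCast_mul.hasSum hw
    have h2 := hu.natCast_mul.coeffShift.hasSum hw
    rw [psum_coeffShift hu.natCast_mul hw] at h2
    rw [psum_natCast_mul hu hw] at h1 h2
    have h4 := hu.coeffShift.hasSum hw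
    rw [psum_coeffShift hu hw] at h4
    refine HasSum.of_coeff (((h1.sub h2).add
      (((hu.hasSum hw).mul_left (a + b)).sub (h4.mul_left b))).mul_left a⁻¹) (fun k => ?_) (by ring)
    rw [inv_mul_eq_iff_eq_mul₀ ha0]
    cases k with
    | zero =>
      have hab0 : a + b ≠ 0 := by simpa using hab 0
      rw [← mul_assoc a, gaussCoeff_lower_zero ha0 hab0]
      simp only [coeffShift, Nat.cast_zero]
      ring
    | succ k =>
      simp only [coeffShift]
      rw [← mul_assoc a, gaussCoeff_lower ha0 hab]
      push_cast
      ring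
  -- The new continuation is a first-order operator applied to the old one; the three `HasSum`
  -- statements give its effect on the logarithmic, regular and Gauss coefficients.
  refine ⟨fun z hz => (hreg hz).summable, fun z hz => (hlog hz).summable,
    fun w => a⁻¹ * (w * (1 - w) * deriv f w + (a + b - b * w) * f w), ?_, ?_, ?_⟩
  · have hd := hf.deriv isOpen_cutPlane
    fun_prop
  · intro w hw
    beta_reduce
    rw [(hgauss hw).psum_eq, deriv_eq_psum_coeffDeriv hu hball hw, hball w hw]
  · intro z hz hzs
    have hz0 := slitPlane_ne_zero hzs
    beta_reduce
    rw [(hreg hz).psum_eq, (hlog hz).psum_eq, hderiv hz hzs, hexp z hz hzs]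
    field_simp
    ring

/-! ### Contiguity in the third parameter. -/

theorem ConvOnDisc.iterate_coeffShift {u : ℕ → ℂ} (hu : ConvOnDisc u) (n : ℕ) :
    ConvOnDisc (_root_.coeffShift^[n] u) := by
  induction n with
  | zero => exact hu
  | succ n ih =>
    rw [Function.iterate_succ_apply']
    exact ih.coeffShift

theorem psum_iterate_coeffShift {u : ℕ → ℂ} (hu : ConvOnDisc u) (n : ℕ) {z : ℂ} (hz : ‖z‖ < 1) :
    psum (coeffShift^[n] u) z = z ^ n * psum u z := by
  induction n with
  | zero => simp
  | succ n ih =>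
    rw [Function.iterate_succ_apply', psum_coeffShift (hu.iterate_coeffShift n) hz, ih]
    ring

theorem iterate_coeffShift_of_lt (u : ℕ → ℂ) {n k : ℕ} (hk : k < n) :
    coeffShift^[n] u k = 0 := by
  induction n generalizing k with
  | zero => omega
  | succ n ih =>
    rw [Function.iterate_succ_apply']
    cases k with
    | zero => rfl
    | succ k => exact ih (by omega)

theorem iterate_coeffShift_add (u : ℕ → ℂ) (n k : ℕ) : coeffShift^[n] u (n + k) = u k := by
  induction n with
  | zero => simp
  | succ n ih =>
    rw [Function.iterate_succ_apply', show n + 1 + k = (n + k) + 1 by omega]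
    exact ih

theorem pochQuot_succ (μ ν : ℂ) (n j : ℕ) :
    pochQuot μ ν n (j + 1) = (μ - n + j) * (ν - n + j) / (j + 1) * pochQuot μ ν n j := by
  have h4 : (j.factorial : ℂ) ≠ 0 := by exact_mod_cast j.factorial_ne_zero
  have h5 : ((j : ℂ) + 1) ≠ 0 := by exact_mod_cast j.succ_ne_zero
  simp only [pochQuot, poch_succ, Nat.factorial_succ]
  push_cast
  field_simp

theorem pochQuot_succ_succ (μ ν : ℂ) (n j : ℕ) :
    pochQuot μ ν (n + 1) (j + 1)
      = (μ - n - 1) * (ν - n - 1) / (j + 1) * pochQuot μ ν n j := by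
  have h4 : (j.factorial : ℂ) ≠ 0 := by exact_mod_cast j.factorial_ne_zero
  have h5 : ((j : ℂ) + 1) ≠ 0 := by exact_mod_cast j.succ_ne_zero
  simp only [pochQuot, poch_succ_left, Nat.factorial_succ]
  push_cast
  rw [show μ - (n + 1) + 1 = μ - n by ring, show ν - (n + 1) + 1 = ν - n by ring]
  field_simp
  ring

theorem logCoeff_succ (μ ν : ℂ) (n k : ℕ) :
    logCoeff μ ν n (k + 1)
      = (μ + k) * (ν + k) / ((n + k + 1) * (k + 1)) * logCoeff μ ν n k := by
  have h4 : (k.factorial : ℂ) ≠ 0 := by exact_mod_cast k.factorial_ne_zero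
  have h5 : ((k : ℂ) + 1) ≠ 0 := by exact_mod_cast k.succ_ne_zero
  have h6 : ((n : ℂ) + k + 1) ≠ 0 := by exact_mod_cast (n + k).succ_ne_zero
  simp only [logCoeff, ← add_assoc, pochQuot_succ, Nat.factorial_succ]
  push_cast
  field_simp
  ring

theorem logCoeff_succ_left (μ ν : ℂ) (n k : ℕ) :
    logCoeff μ ν (n + 1) k
      = -((μ - n - 1) * (ν - n - 1) / (n + k + 1)) * logCoeff μ ν n k := by
  have h4 : (k.factorial : ℂ) ≠ 0 := by exact_mod_cast k.factorial_ne_zero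
  have h6 : ((n : ℂ) + k + 1) ≠ 0 := by exact_mod_cast (n + k).succ_ne_zero
  simp only [logCoeff, show n + 1 + k = (n + k) + 1 by omega, pochQuot_succ_succ]
  push_cast
  field_simp
  ring

theorem digammaSum_succ_left (μ ν : ℂ) (n k : ℕ) :
    digammaSum μ ν (n + 1) k = digammaSum μ ν n k + 1 / (n + k + 1) := by
  have h2 := digamma_apply_add_one (k + n + 1 : ℂ)
    (ne_neg_natCast_of_re_pos (by simp; positivity))
  simp only [digammaSum]
  push_cast
  rw [← add_assoc (k : ℂ), h2, add_comm (n : ℂ) k]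
  ring

theorem regCoeff_add (μ ν : ℂ) (n k : ℕ) :
    regCoeff μ ν n (n + k) = logCoeff μ ν n k * digammaSum μ ν n k := by
  simp [regCoeff]

theorem regCoeff_of_lt (μ ν : ℂ) {n j : ℕ} (h : j < n) :
    regCoeff μ ν n j = (-1) ^ j * (n - 1 - j).factorial * pochQuot μ ν n j := by
  simp [regCoeff, h]

theorem regCoeff_raise_zero (μ ν : ℂ) (n : ℕ) :
    regCoeff μ ν (n + 1) 0 = n * regCoeff μ ν n 0 + coeffShift^[n] (logCoeff μ ν n) 0 := by
  rw [regCoeff_of_lt μ ν n.succ_pos]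
  cases n with
  | zero => simp [logCoeff, pochQuot, poch_zero]
  | succ n =>
    rw [regCoeff_of_lt μ ν n.succ_pos, iterate_coeffShift_of_lt _ n.succ_pos]
    simp [pochQuot, poch_zero, Nat.factorial_succ]

/-- This is the coefficient form of applying `-(1 - z) d/dz + c`, with `c = μ + ν - (n + 1)`, and
multiplying by `z ^ (n + 1)`. The shifted terms come from the derivative of `log z`. The three cases
are the polar part, its new last coefficient, and the digamma tail. -/
theorem regCoeff_raise {μ ν : ℂ} (hμ : ∀ m : ℕ, μ ≠ -m) (hν : ∀ m : ℕ, ν ≠ -m) (n i : ℕ) :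
    regCoeff μ ν (n + 1) (i + 1)
      = (n - (i + 1)) * regCoeff μ ν n (i + 1) + (i - n + (μ + ν - (n + 1))) * regCoeff μ ν n i
        + coeffShift^[n] (logCoeff μ ν n) (i + 1) - coeffShift^[n] (logCoeff μ ν n) i := by
  have hi : ((i : ℂ) + 1) ≠ 0 := by exact_mod_cast i.succ_ne_zero
  rcases lt_trichotomy (i + 1) n with h | h | h
  · obtain ⟨m, rfl⟩ := Nat.exists_eq_add_of_lt h
    rw [regCoeff_of_lt μ ν (by omega), regCoeff_of_lt μ ν h, regCoeff_of_lt μ ν (by omega),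
      iterate_coeffShift_of_lt _ h, iterate_coeffShift_of_lt _ (by omega), pochQuot_succ_succ,
      pochQuot_succ, show i + 1 + m + 1 + 1 - 1 - (i + 1) = m + 1 by omega,
      show i + 1 + m + 1 - 1 - (i + 1) = m by omega,
      show i + 1 + m + 1 - 1 - i = m + 1 by omega, Nat.factorial_succ]
    push_cast
    field_simp
    ring
  -- At the boundary the factor `n - (i + 1)` vanishes, so the digamma values drop out and the
  -- leading logarithmic coefficient supplies the new polar coefficient.
  · subst h
    have h1 : regCoeff μ ν (i + 1) (i + 1) = _ := regCoeff_add μ ν (i + 1) 0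
    have h2 := iterate_coeffShift_add (logCoeff μ ν (i + 1)) (i + 1) 0
    rw [add_zero] at h2
    rw [regCoeff_of_lt μ ν (show i + 1 < i + 1 + 1 by omega), h1,
      regCoeff_of_lt μ ν (show i < i + 1 by omega), h2,
      iterate_coeffShift_of_lt _ (by omega), pochQuot_succ_succ, logCoeff, add_zero,
      pochQuot_succ, show i + 1 + 1 - 1 - (i + 1) = 0 by omega,
      show i + 1 - 1 - i = 0 by omega, Nat.factorial_zero]
    push_cast
    field_simp
    ring
  · obtain ⟨m, rfl⟩ := Nat.exists_eq_add_of_le (Nat.lt_succ_iff.1 h)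
    have h1 : regCoeff μ ν (n + 1) (n + m + 1)
        = logCoeff μ ν (n + 1) m * digammaSum μ ν (n + 1) m := by
      rw [show n + m + 1 = (n + 1) + m by omega]
      exact regCoeff_add μ ν (n + 1) m
    rw [h1, add_assoc n m 1, regCoeff_add, regCoeff_add, iterate_coeffShift_add,
      iterate_coeffShift_add, logCoeff_succ_left, digammaSum_succ_left, digammaSum_succ hμ hν,
      logCoeff_succ]
    have h5 : ((m : ℂ) + 1) ≠ 0 := by exact_mod_cast m.succ_ne_zero
    have h6 : ((n : ℂ) + m + 1) ≠ 0 := by exact_mod_cast (n + m).succ_ne_zero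
    have h7 := add_natCast_ne_zero hμ m
    have h8 := add_natCast_ne_zero hν m
    rw [add_comm (m : ℂ) n, add_comm (m : ℂ) μ, add_comm (m : ℂ) ν]
    push_cast
    field_simp
    ring

/-- From `(c)_k (c + k) = c (c + 1)_k` and `Γ(c + 1) = c Γ(c)`. The factor `k + c` is the action of
`w d/dw + c` on `w ^ k`. -/
theorem gaussCoeff_raise {a b c : ℂ} (hc : ∀ m : ℕ, c ≠ -m) (k : ℕ) :
    gaussCoeff a b c k = (k + c) * gaussCoeff a b (c + 1) k := by
  have hc0 : c ≠ 0 := by simpa using hc 0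
  have hc1 := ne_neg_natCast_add hc 1
  rw [Nat.cast_one] at hc1
  have h1 := poch_ne_zero hc1 k
  have h2 := poch_ne_zero hc k
  have h3 := Gamma_ne_zero hc
  have h4 : (k.factorial : ℂ) ≠ 0 := by exact_mod_cast k.factorial_ne_zero
  have h5 : poch c k * (c + k) = c * poch (c + 1) k := by rw [← poch_succ, poch_succ_left]
  rw [gaussCoeff, gaussCoeff, Gamma_add_one c hc0]
  field_simp
  linear_combination -(Gamma a * Gamma b * poch a k * poch b k) * h5

/-- Passing from `μ + ν - n` to `μ + ν - (n + 1)` in the third parameter. -/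
theorem HasLogExpansion.raise {μ ν : ℂ} {n : ℕ} (h : HasLogExpansion μ ν n)
    (hμ : ∀ m : ℕ, μ ≠ -m) (hν : ∀ m : ℕ, ν ≠ -m)
    (hc : ∀ m : ℕ, μ + ν - ((n + 1 : ℕ) : ℂ) ≠ -m) : HasLogExpansion μ ν (n + 1) := by
  obtain ⟨hp, hq, f, hf, hball, hexp⟩ := h
  have hderiv := fun {z : ℂ} (hz : ‖z‖ < 1) (hzs : z ∈ slitPlane) =>
    deriv_eq_of_log_expansion hp hq hf hexp hz hzs
  have hu := convOnDisc_gaussCoeff μ ν (μ + ν - n)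
  set c : ℂ := μ + ν - ((n + 1 : ℕ) : ℂ) with hcdef
  have hcn : μ + ν - n = c + 1 := by
    rw [hcdef]
    push_cast
    ring
  have hcn' : μ + ν - (n + 1) = c := by
    rw [hcdef]
    push_cast
    ring
  have hlog : ∀ {z : ℂ}, ‖z‖ < 1 → HasSum (fun k => logCoeff μ ν (n + 1) k * z ^ k)
      (-(1 - z) * psum (coeffDeriv (logCoeff μ ν n)) z + c * psum (logCoeff μ ν n) z) := by
    intro z hz
    have h1 := hq.natCast_mul.hasSum hz
    rw [psum_natCast_mul hq hz] at h1
    refine HasSum.of_coeff ((h1.sub (hq.coeffDeriv.hasSum hz)).add ((hq.hasSum hz).mul_left c))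
      (fun k => ?_) (by ring)
    have h5 : ((k : ℂ) + 1) ≠ 0 := by exact_mod_cast k.succ_ne_zero
    have h6 : ((n : ℂ) + k + 1) ≠ 0 := by exact_mod_cast (n + k).succ_ne_zero
    rw [coeffDeriv, logCoeff_succ, logCoeff_succ_left, ← hcn']
    field_simp
    ring
  have hreg : ∀ {z : ℂ}, ‖z‖ < 1 → HasSum (fun k => regCoeff μ ν (n + 1) k * z ^ k)
      (-(1 - z) * (z * psum (coeffDeriv (regCoeff μ ν n)) z - n * psum (regCoeff μ ν n) z)
        + (1 - z) * (z ^ n * psum (logCoeff μ ν n) z) + c * (z * psum (regCoeff μ ν n) z)) := by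
    intro z hz
    have h1 := hp.natCast_mul.hasSum hz
    have h2 := hp.natCast_mul.coeffShift.hasSum hz
    rw [psum_coeffShift hp.natCast_mul hz] at h2
    rw [psum_natCast_mul hp hz] at h1 h2
    have h3 := hp.hasSum hz
    have h4 := hp.coeffShift.hasSum hz
    rw [psum_coeffShift hp hz] at h4
    have hq' := hq.iterate_coeffShift n
    have h5 := hq'.hasSum hz
    have h6 := hq'.coeffShift.hasSum hz
    rw [psum_coeffShift hq' hz] at h6
    rw [psum_iterate_coeffShift hq n hz] at h5 h6
    refine HasSum.of_coeff ((((h2.sub h1).add ((h3.sub h4).mul_left (n : ℂ))).add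
      (h5.sub h6)).add (h4.mul_left c)) (fun k => ?_) (by ring)
    cases k with
    | zero =>
      rw [regCoeff_raise_zero]
      simp only [coeffShift, Nat.cast_zero]
      ring
    | succ k =>
      rw [regCoeff_raise hμ hν, hcn']
      simp only [coeffShift]
      push_cast
      ring
  have hgauss : ∀ {w : ℂ}, ‖w‖ < 1 → HasSum (fun k => gaussCoeff μ ν c k * w ^ k)
      (w * psum (coeffDeriv (gaussCoeff μ ν (c + 1))) w
        + c * psum (gaussCoeff μ ν (c + 1)) w) := by
    intro w hw
    rw [hcn] at hu
    have h1 := hu.natCast_mul.hasSum hw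
    rw [psum_natCast_mul hu hw] at h1
    refine HasSum.of_coeff (h1.add ((hu.hasSum hw).mul_left c)) (fun k => ?_) rfl
    rw [gaussCoeff_raise hc]
    ring
  refine ⟨fun z hz => (hreg hz).summable, fun z hz => (hlog hz).summable,
    fun w => w * deriv f w + c * f w, ?_, ?_, ?_⟩
  · have hd := hf.deriv isOpen_cutPlane
    fun_prop
  · intro w hw
    beta_reduce
    rw [(hgauss hw).psum_eq, deriv_eq_psum_coeffDeriv hu hball hw, hball w hw, hcn]
  · intro z hz hzs
    have hz0 := slitPlane_ne_zero hzs
    beta_reduce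
    rw [(hreg hz).psum_eq, (hlog hz).psum_eq, hderiv hz hzs, hexp z hz hzs]
    field_simp
    ring

/-! ### Descent to all admissible parameters. -/

theorem hasLogExpansion_zero {a b : ℂ} (ha : ∀ m : ℕ, a ≠ -m) (hb : ∀ m : ℕ, b ≠ -m)
    (hab : ∀ m : ℕ, a + b ≠ -m) : HasLogExpansion a b 0 := by
  -- `N` bounds the number of unit steps by which `Re a` falls short of `2`. `key'` does the same
  -- for `b` by symmetry.
  have key : ∀ (N : ℕ) {a b : ℂ}, 2 ≤ b.re → 2 ≤ a.re + N → (∀ m : ℕ, a ≠ -m) →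
      (∀ m : ℕ, b ≠ -m) → (∀ m : ℕ, a + b ≠ -m) → HasLogExpansion a b 0 := by
    intro N
    induction N with
    | zero =>
      intro a b h2 h1 _ _ _
      exact hasLogExpansion_zero_of_two_le_re (by simpa using h1) h2
    | succ N ih =>
      intro a b h2 h1 ha hb hab
      have ha1 := ne_neg_natCast_add ha 1
      have hab1 := ne_neg_natCast_add hab 1
      rw [Nat.cast_one] at ha1 hab1
      refine (ih h2 ?_ ha1 hb fun m => ?_).lower ha hb hab
      · rw [add_re, one_re]
        push_cast at h1
        linarith
      · rw [add_right_comm]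
        exact hab1 m
  have key' : ∀ (N : ℕ) {b : ℂ}, 2 ≤ b.re + N → (∀ m : ℕ, b ≠ -m) →
      (∀ m : ℕ, a + b ≠ -m) → HasLogExpansion a b 0 := by
    intro N
    induction N with
    | zero =>
      intro b h2 hb hab
      obtain ⟨M, hM⟩ := exists_nat_ge (2 - a.re)
      exact key M (by simpa using h2) (by linarith) ha hb hab
    | succ N ih =>
      intro b h2 hb hab
      have hb1 := ne_neg_natCast_add hb 1
      have hab1 := ne_neg_natCast_add hab 1
      rw [Nat.cast_one] at hb1 hab1
      refine ((ih ?_ hb1 fun m => ?_).symm.lower hb ha fun m => ?_).symm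
      · rw [add_re, one_re]
        push_cast at h2
        linarith
      · rw [← add_assoc]
        exact hab1 m
      · rw [add_comm]
        exact hab m
  obtain ⟨N, hN⟩ := exists_nat_ge (2 - b.re)
  exact key' N (by linarith) hb hab

theorem hasLogExpansion {μ ν : ℂ} (hμ : ∀ m : ℕ, μ ≠ -m) (hν : ∀ m : ℕ, ν ≠ -m) (n : ℕ)
    (hc : ∀ m : ℕ, μ + ν - n ≠ -m) : HasLogExpansion μ ν n := by
  induction n with
  | zero => exact hasLogExpansion_zero hμ hν (by simpa using hc)
  | succ n ih =>
    refine (ih fun m h => ?_).raise hμ hν hc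
    refine ne_neg_natCast_add hc 1 m ?_
    rw [← h]
    push_cast
    ring

/-! ### The transformation formulas -/

/-- Stated for reciprocals so that it also holds at the poles of `Γ`; thus `μ - n` and `ν - n` may
be nonpositive integers. -/
theorem inv_Gamma_eq_poch_mul (s : ℂ) (n : ℕ) :
    (Gamma s)⁻¹ = poch s n * (Gamma (s + n))⁻¹ := by
  induction n with
  | zero => simp [poch_zero]
  | succ n ih =>
    have h := one_div_Gamma_eq_self_mul_one_div_Gamma_add_one (s + n)
    rw [ih, poch_succ]
    push_cast
    rw [h, ← add_assoc]
    ring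

theorem poch_one_sub_mul {n k : ℕ} (hk : k < n) :
    poch (1 - n) k * ((-1) ^ k * ((n - 1 - k).factorial : ℂ)) = ((n - 1).factorial : ℂ) := by
  induction k with
  | zero => simp [poch_zero]
  | succ k ih =>
    obtain ⟨m, rfl⟩ := Nat.exists_eq_add_of_lt hk
    rw [← ih (by omega), poch_succ, show k + 1 + m + 1 - 1 - k = m + 1 by omega,
      show k + 1 + m + 1 - 1 - (k + 1) = m by omega, Nat.factorial_succ]
    push_cast
    ring

theorem factorial_mul_poch (n k : ℕ) : (n.factorial : ℂ) * poch (n + 1) k = (n + k).factorial := by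
  rw [← poch_one, ← poch_one, poch_add, add_comm (n : ℂ)]

/-- Coefficients of the Gauss series `₂F₁(μ, ν; n + 1; z)`. -/
noncomputable def gaussSeriesCoeff (μ ν : ℂ) (n k : ℕ) : ℂ :=
  poch μ k * poch ν k / (poch (n + 1) k * k.factorial)

theorem convOnDisc_gaussSeriesCoeff (μ ν : ℂ) (n : ℕ) : ConvOnDisc (gaussSeriesCoeff μ ν n) := by
  have := convOnDisc_poch_div μ ν (n + 1) 1
  simp only [poch_one] at this
  exact this

theorem psum_gaussSeriesCoeff (μ ν : ℂ) (n : ℕ) (z : ℂ) : psum (gaussSeriesCoeff μ ν n) z = ₂F₁ μ ν (n + 1 : ℂ) z := by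
  rw [psum, ordinaryHypergeometric_eq_tsum]
  refine tsum_congr fun k => ?_
  simp only [gaussSeriesCoeff, poch, smul_eq_mul, div_eq_mul_inv, mul_inv]
  ring

theorem convOnDisc_gaussSeriesCoeff_mul_digammaSum {μ ν : ℂ} (hμ : ∀ m : ℕ, μ ≠ -m)
    (hν : ∀ m : ℕ, ν ≠ -m) (n : ℕ) :
    ConvOnDisc fun k => gaussSeriesCoeff μ ν n k * digammaSum μ ν n k :=
  (convOnDisc_gaussSeriesCoeff μ ν n).mul_of_norm_le (exists_norm_digammaSum_le hμ hν n).choose_spec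

/-- Splitting `(μ - n)_{n + k} = (μ - n)_n (μ)_k` isolates a constant, later absorbed into the
reciprocal Gamma factors. -/
theorem logCoeff_eq_mul_gaussSeriesCoeff (μ ν : ℂ) (n k : ℕ) :
    logCoeff μ ν n k
      = (-1) ^ n * (poch (μ - n) n * poch (ν - n) n / n.factorial) * gaussSeriesCoeff μ ν n k := by
  have h1 : (n.factorial : ℂ) ≠ 0 := by exact_mod_cast n.factorial_ne_zero
  have h2 : poch ((n : ℂ) + 1) k ≠ 0 :=
    poch_ne_zero (ne_neg_natCast_of_re_pos (by simp; positivity)) k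
  have h3 : (k.factorial : ℂ) ≠ 0 := by exact_mod_cast k.factorial_ne_zero
  rw [logCoeff, pochQuot, gaussSeriesCoeff, poch_add, poch_add, sub_add_cancel, sub_add_cancel,
    ← factorial_mul_poch]
  field_simp

theorem logTerm_eq (μ ν : ℂ) (n : ℕ) (w : ℂ) (k : ℕ) :
    logTerm μ ν n w k = gaussSeriesCoeff μ ν n k * digammaSum μ ν n k * (1 - w) ^ k
      - log (1 - w) * (gaussSeriesCoeff μ ν n k * (1 - w) ^ k) := by
  rw [logTerm, gaussSeriesCoeff, digammaSum]
  ring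

theorem digammaTerm_eq {μ ν ρ : ℂ} {n : ℕ} (h : ν - ρ = n) (z : ℂ) (k : ℕ) :
    digammaTerm μ ν ρ z k = gaussSeriesCoeff μ ν n k * digammaSum μ ν n k * z ^ k := by
  rw [digammaTerm, gaussSeriesCoeff, digammaSum, h, show k + ν + 1 - ρ = k + n + 1 by rw [← h]; ring]
  ring

theorem hasSum_logTerm {μ ν : ℂ} (hμ : ∀ m : ℕ, μ ≠ -m) (hν : ∀ m : ℕ, ν ≠ -m) (n : ℕ) {w : ℂ}
    (hw : ‖1 - w‖ < 1) :
    HasSum (logTerm μ ν n w) (psum (fun k => gaussSeriesCoeff μ ν n k * digammaSum μ ν n k) (1 - w)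
      - log (1 - w) * psum (gaussSeriesCoeff μ ν n) (1 - w)) := by
  have h := ((convOnDisc_gaussSeriesCoeff_mul_digammaSum hμ hν n).hasSum hw).sub
    (((convOnDisc_gaussSeriesCoeff μ ν n).hasSum hw).mul_left (log (1 - w)))
  rw [funext (logTerm_eq μ ν n w)]
  exact h

/-- Convergence of the two partial series lets `log (1 - w)` be pulled out of the combined sum; the
rest is `Γ(n) = (n - 1)!` and `Γ(n + 1) = n!`. -/
theorem reprRhs_eq_logRhs {μ ν : ℂ} (hμ : ∀ m : ℕ, μ ≠ -m) (hν : ∀ m : ℕ, ν ≠ -m) {n : ℕ}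
    (hn : 0 < n) {w : ℂ} (hw : ‖1 - w‖ < 1) :
    reprRhs μ ν (ν - n) n (1 - w) = logRhs μ ν n w := by
  have h1 : Gamma (n : ℂ) = ((n - 1).factorial : ℂ) := by
    obtain ⟨m, rfl⟩ := Nat.exists_eq_succ_of_ne_zero hn.ne'
    rw [Nat.succ_eq_add_one, Nat.add_sub_cancel]
    push_cast
    exact Gamma_nat_eq_factorial m
  have h2 : (fun k => digammaTerm μ ν (ν - n) (1 - w) k)
      = fun k => gaussSeriesCoeff μ ν n k * digammaSum μ ν n k * (1 - w) ^ k :=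
    funext fun k => digammaTerm_eq (sub_sub_cancel ν (n : ℂ)) (1 - w) k
  rw [reprRhs, logRhs, (hasSum_logTerm hμ hν n hw).tsum_eq, h2, sub_sub_cancel, h1,
    Gamma_nat_eq_factorial, ← psum_gaussSeriesCoeff, psum,
    show μ - ν + (ν - n) = μ - n by ring, show 1 - ν + (ν - n) = 1 - n by ring,
    show μ + (ν - n) = μ + ν - n by ring]
  simp only [psum, div_eq_mul_inv, mul_inv]
  ring

theorem psum_regCoeff_div {μ ν : ℂ} {n : ℕ} (h : ConvOnDisc (regCoeff μ ν n)) {z : ℂ}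
    (hz : ‖z‖ < 1) (hz0 : z ≠ 0) :
    psum (regCoeff μ ν n) z / z ^ n
      = (∑ k ∈ Finset.range n, regCoeff μ ν n k * z ^ k) / z ^ n
        + psum (fun k => logCoeff μ ν n k * digammaSum μ ν n k) z := by
  rw [psum, ← (h z hz).sum_add_tsum_nat_add n, add_div, psum, ← tsum_div_const]
  congr 1
  refine tsum_congr fun k => ?_
  rw [add_comm k n, regCoeff_add, pow_add]
  field_simp

theorem logRhs_eq {μ ν : ℂ} (hμ : ∀ m : ℕ, μ ≠ -m) (hν : ∀ m : ℕ, ν ≠ -m) {n : ℕ}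
    (h : ConvOnDisc (regCoeff μ ν n)) {z : ℂ} (hz : ‖z‖ < 1) (hz0 : z ≠ 0) :
    logRhs μ ν n (1 - z) = Gamma (μ + ν - n) / (Gamma μ * Gamma ν)
      * (psum (regCoeff μ ν n) z / z ^ n - log z * psum (logCoeff μ ν n) z) := by
  set κ : ℂ := (-1) ^ n * (poch (μ - n) n * poch (ν - n) n / n.factorial) with hκ
  have h1 : psum (logCoeff μ ν n) z = κ * psum (gaussSeriesCoeff μ ν n) z := by
    rw [← psum_const_mul]
    congr 1
    exact funext fun k => logCoeff_eq_mul_gaussSeriesCoeff μ ν n k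
  have h2 : psum (fun k => logCoeff μ ν n k * digammaSum μ ν n k) z
      = κ * psum (fun k => gaussSeriesCoeff μ ν n k * digammaSum μ ν n k) z := by
    rw [← psum_const_mul]
    congr 1
    funext k
    rw [logCoeff_eq_mul_gaussSeriesCoeff, mul_assoc κ]
  have h3 : ((n - 1).factorial : ℂ) * (∑ k ∈ Finset.range n,
        poch (ν - n) k * poch (μ - n) k / (poch (1 - n) k * (k.factorial : ℂ)) * z ^ k)
      = ∑ k ∈ Finset.range n, regCoeff μ ν n k * z ^ k := by
    rw [Finset.mul_sum]
    refine Finset.sum_congr rfl fun k hk => ?_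
    have hk' := Finset.mem_range.1 hk
    -- The denominator `(1 - n)_k` is nonzero for `k < n`, and dividing `(n - 1)!` by it gives
    -- `(-1)^k (n - 1 - k)!`.
    have h4 := poch_one_sub_mul hk'
    have h5 : poch (1 - n) k ≠ 0 := fun h0 => by
      rw [h0, zero_mul] at h4
      exact Nat.factorial_ne_zero _ (by exact_mod_cast h4.symm)
    have h6 : (k.factorial : ℂ) ≠ 0 := by exact_mod_cast k.factorial_ne_zero
    rw [regCoeff_of_lt μ ν hk', pochQuot, ← h4]
    field_simp
  have h4 := inv_Gamma_eq_poch_mul (μ - n) n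
  have h5 := inv_Gamma_eq_poch_mul (ν - n) n
  rw [sub_add_cancel] at h4 h5
  rw [psum_regCoeff_div h hz hz0, h1, h2, ← h3, logRhs,
    (hasSum_logTerm hμ hν n (w := 1 - z) (by rwa [sub_sub_cancel])).tsum_eq, sub_sub_cancel]
  simp only [div_eq_mul_inv, mul_inv, h4, h5, hκ]
  ring

theorem gaussBranch_and_logRhs {μ ν : ℂ} (hμ : ∀ m : ℕ, μ ≠ -m) (hν : ∀ m : ℕ, ν ≠ -m) {n : ℕ}
    (hc : ∀ m : ℕ, μ + ν - n ≠ -m) :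
    IsGaussBranch μ ν (μ + ν - n) (gaussF μ ν (μ + ν - n)) ∧
    ∀ z : ℂ, ‖z‖ < 1 → z ∈ slitPlane →
      gaussF μ ν (μ + ν - n) (1 - z) = logRhs μ ν n (1 - z) := by
  obtain ⟨hp, hq, f, hf, hball, hexp⟩ := hasLogExpansion hμ hν n hc
  have hΓμ := Gamma_ne_zero hμ
  have hΓν := Gamma_ne_zero hν
  have hΓc := Gamma_ne_zero hc
  have hF : IsGaussBranch μ ν (μ + ν - n)
      (fun w => Gamma (μ + ν - n) / (Gamma μ * Gamma ν) * f w) := by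
    refine ⟨hf.const_mul _, fun w hw => ?_⟩
    rw [hball w (mem_ball_zero_iff.1 hw), psum_gaussCoeff]
    field_simp
  have hG : IsGaussBranch μ ν (μ + ν - n) (gaussF μ ν (μ + ν - n)) := by
    have hex : ∃ F : ℂ → ℂ, IsGaussBranch μ ν (μ + ν - n) F := ⟨_, hF⟩
    rw [gaussF, dif_pos hex]
    exact hex.choose_spec
  refine ⟨hG, fun z hz hzs => ?_⟩
  rw [hG.unique hF (one_sub_mem_cutPlane hzs), logRhs_eq hμ hν hp hz (slitPlane_ne_zero hzs)]
  rw [← hexp z hz hzs]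

theorem mem_slitPlane_of_abs_arg_lt {z : ℂ} (h0 : z ≠ 0) (h : |z.arg| < Real.pi) :
    z ∈ slitPlane :=
  mem_slitPlane_iff_arg.2 ⟨fun h' => by rw [h', abs_of_pos Real.pi_pos] at h; exact h.false, h0⟩

theorem mainTheorem6 :
    -- the representation of `₂F₁(μ, ν; μ + ρ; 1 - z)`
    (∀ (μ ν ρ : ℂ) (n : ℕ), 0 < n → ν - ρ = n → 0 < ρ.re → (∀ m : ℤ, ρ ≠ m) →
      0 < (ρ - ν + μ).re →
      IsGaussBranch μ ν (μ + ρ) (gaussF μ ν (μ + ρ)) ∧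
      ∀ z : ℂ, ‖z‖ < 1 → z ≠ 0 → |z.arg| < Real.pi →
        Summable (digammaTerm μ ν ρ z) ∧
        gaussF μ ν (μ + ρ) (1 - z) = reprRhs μ ν ρ n z) ∧
    -- the logarithmic transformation of `₂F₁(μ, ν; μ + ν - n; w)`
    (∀ (μ ν : ℂ) (n : ℕ), 0 < n → (∀ m : ℕ, μ ≠ -m) → (∀ m : ℕ, ν ≠ -m) →
      (∀ m : ℕ, μ + ν - n ≠ -m) →
      IsGaussBranch μ ν (μ + ν - n) (gaussF μ ν (μ + ν - n)) ∧
      ∀ w : ℂ, ‖1 - w‖ < 1 → 1 - w ≠ 0 → |(1 - w).arg| < Real.pi →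
        Summable (logTerm μ ν n w) ∧
        gaussF μ ν (μ + ν - n) w = logRhs μ ν n w) ∧
    -- the two formulas are the same under `ρ = ν - n`, `z = 1 - w`
    (∀ (μ ν : ℂ) (n : ℕ), 0 < n → (∀ m : ℕ, μ ≠ -m) → (∀ m : ℕ, ν ≠ -m) →
      (∀ m : ℕ, μ + ν - n ≠ -m) →
      ∀ w : ℂ, ‖1 - w‖ < 1 → 1 - w ≠ 0 → |(1 - w).arg| < Real.pi →
        reprRhs μ ν (ν - n) n (1 - w) = logRhs μ ν n w) := by
  refine ⟨fun μ ν ρ n hn hνρ hρ hρ' hμ => ?_, fun μ ν n hn hμ hν hc => ?_,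
    fun μ ν n hn hμ hν hc w hw _ _ => reprRhs_eq_logRhs hμ hν hn hw⟩
  · obtain rfl : ρ = ν - n := by rw [← hνρ]; ring
    have hμ' : ∀ m : ℕ, μ ≠ -m := by
      refine ne_neg_natCast_of_re_pos ?_
      simp only [sub_re, add_re, natCast_re] at hμ
      linarith [n.cast_nonneg (α := ℝ)]
    -- If `ν` were a nonpositive integer, `ρ = ν - n` would be an integer.
    have hν' : ∀ m : ℕ, ν ≠ -m := fun m h => hρ' (-m - n) (by rw [h]; push_cast; ring)
    have hc : ∀ m : ℕ, μ + ν - n ≠ -m := by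
      refine ne_neg_natCast_of_re_pos ?_
      simp only [sub_re, add_re, natCast_re] at hμ hρ ⊢
      linarith [n.cast_nonneg (α := ℝ)]
    obtain ⟨hG, hlog⟩ := gaussBranch_and_logRhs hμ' hν' hc
    rw [show μ + (ν - n) = μ + ν - n by ring]
    refine ⟨hG, fun z hz hz0 harg => ⟨?_, ?_⟩⟩
    · rw [funext (digammaTerm_eq hνρ z)]
      exact convOnDisc_gaussSeriesCoeff_mul_digammaSum hμ' hν' n z hz
    · have hrepr := reprRhs_eq_logRhs hμ' hν' hn (w := 1 - z) (by rwa [sub_sub_cancel])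
      rw [sub_sub_cancel] at hrepr
      rw [hlog z hz (mem_slitPlane_of_abs_arg_lt hz0 harg), hrepr]
  · obtain ⟨hG, hlog⟩ := gaussBranch_and_logRhs hμ hν hc
    refine ⟨hG, fun w hw hw0 harg => ⟨(hasSum_logTerm hμ hν n hw).summable, ?_⟩⟩
    have := hlog (1 - w) hw (mem_slitPlane_of_abs_arg_lt hw0 harg)
    rwa [sub_sub_cancel] at this
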